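/- **Soundness of $\mathbf P$-schemata.** *Language and calculus.* Consider a two-sorted first-order language with a numeric sort $\omega$ (with $0$, $s$), an individual sort $\iota$, function and predicate symbols, some of them *defined*, and three disjoint kinds of free variables of sort $\omega$: active, passive and internal parameters. Let $\mathcal E$ be a convergent (terminating and confluent) set of rewrite rules $\hat f(\bar t)\to E$, $\hat P(\bar t)\to E$ for the defined symbols, with $\bar t$ free of defined symbols; let $\mathrm{Ax}$ be a (possibly empty) set of nonlogical axiom sequents closed under substitution. The calculus has initial sequents $A\vdash A$ and those of $\mathrm{Ax}$, the rules of $\mathbf{LK}$ (only passive parameters and $\iota$-variables may be eigenvariables, and weak quantifier rules may not use terms containing active or internal parameters), and the rule $\mathcal E$, which replaces terms and formulas by $\mathcal E$-equal ones. In derivations, leaves may also be *links* to proof symbols. *Schematic terms* are terms built from $0$, $s$ and parameters. *Components.* An $(n,\mathcal I)$-component is a triple $\mathbf C=(\psi,\pi,\nu)$ with a proof symbol $\psi$ and an end-sequent $es(\mathbf C)=S$ whose active parameters are among $\{n\}$ and whose internal parameters are $\mathcal I$; $\pi$ is a derivation of $S\{n\leftarrow0\}$ without active parameters, and $\nu$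 is a derivation of $S\{n\leftarrow s(n)\}$ with no active parameter except $n$. A link to $\mathbf C$ carries the sequent obtained from $S$ by replacing $n$ and the internal parameters by schematic terms and the $\iota$-variables by $\iota$-terms, leaving passive parameters unchanged. (If $n$ does not occur in $S$, the formal argument in place of $n$ must contain no passive and no internal parameter.) $(\mathbf C,\mathbf D)$ are *linkable* if in each sequent of a link in $\mathbf C$ to $\mathbf D$ all passive parameters of $es(\mathbf D)$ occur. *$\mathbf P$-schemata.* For a set $\mathbf P$ of passive parameters, a $\mathbf P$-schema is a finite sequence $\Psi=\langle\mathbf C_1,\dots,\mathbf C_\alpha\rangle$ ($\alpha\ge1$) of components with distinct proof symbols and all passive parameters in $\mathbf P$, with a strict order $\prec^*$ on them such that $\mathbf C\prec^*\mathbf D$ implies that $(\mathbf C,\mathbf D)$ are linkable, and $\mathbf C_1$ is least. Every link leads to a component of $\Psi$; a link from $\mathbf C$ to another component $\mathbf D$ requires $\mathbf C\prec^*\mathbf D$; a link from $\mathbf C$ to itself occurs only in $\nu$ and has $n$ itself as its argument for $n$. Put $es(\Psi)=es(\mathbf C_1)$. *Evaluation.* Links to $\mathbf C=(\psi,\pi,\nu)$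 whose active argument is the numeral $0$ are rewritten to $\pi$, and those whose active argument is a numeral $s(k)$ to $\nu\{n\leftarrow k\}$, the other arguments of the link being substituted as well (without capturing variables by eigenvariables, which are renamed where necessary). Given numerals $\sigma(p)$ for the passive parameters, and numerals for the active and internal parameters, $\Psi\sigma$ denotes the normal form, under these rules, of the link to $\mathbf C_1$ with these arguments, and $es(\Psi)\sigma$ the corresponding instance of $es(\Psi)$. If $es(\Psi)$ contains only passive parameters, then $es(\Psi)\sigma$ depends on $\sigma$ only. *Theory $T$.* A schematic term occurring in a component is *computational* if it contains a passive parameter used as an eigenvariable somewhere in $\Psi$, directly or through an internal parameter for which some link to that component passes a computational term. A sub-$\mathbf P$-schema $\Psi'$ of $\Psi$ is a set of components of $\Psi$ closed under links and having a $\prec^*$-least element, whose end-sequent is $es(\Psi')$. It is computational if some link of $\Psi$ to its least component passes a computational term for the active parameter. $T$ is the set of all end-sequents $es(\Psi')$ of computational sub-$\mathbf P$-schemata $\Psi'$ of $\Psi$, with the active parameter instantiated by a non-ground schematic term over passive parameters, the other numeric parameters by schematic terms over passive parameters, and the $\iota$-variables by terms without active and internal parameters. **Theorem.** For every $\mathbf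 P$-schema $\Psi$ and every substitution $\sigma$ of numerals as above, the normal form $\Psi\sigma$ exists and is unique, and it is an $\mathbf{LK}$-proof of $es(\Psi)\sigma$ over $T$: it contains no active and no internal parameters, its end-sequent is $es(\Psi)\sigma$, each of its leaves is $A\vdash A$, an element of $\mathrm{Ax}$, or an element of $T$ (at the links that are not evaluated), and each of its inferences is an inference of $\mathbf{LK}$ or a trivial $\mathcal E$-inference, i.e. one whose premise and conclusion have the same $\mathcal E$-normal form. -/

import Mathlib

namespace PSchemata

/-! ## The two-sorted schematic language -/

/-- The sorts: `num` is the numeric sort `ω`, `ind` is the individual sort `ι`. -/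
inductive Srt where
  | num
  | ind

/-- A two-sorted signature (zero and successor of the numeric sort are built into the terms).
`DefFn` and `DefPr` single out the defined function and predicate symbols. -/
structure Signature where
  Fn : Type
  dom : Fn → List Srt
  cod : Fn → Srt
  Pr : Type
  par : Pr → List Srt
  DefFn : Set Fn
  DefPr : Set Pr

/-- Free variables: active, passive and internal parameters (all of them of the numeric sort)
and free variables of the individual sort. -/
inductive Var where
  | active (k : ℕ)
  | passive (k : ℕ)
  | internal (k : ℕ)
  | ind (k : ℕ)
  deriving DecidableEq

/-- The sort of a free variable. -/
@[reducible] def Var.sort : Var → Srt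
  | .active _ => .num
  | .passive _ => .num
  | .internal _ => .num
  | .ind _ => .ind

/-- The variables that may serve as eigenvariables: the passive parameters (numeric sort) and the
free variables of the individual sort. -/
def eigen : Srt → ℕ → Var
  | .num, k => .passive k
  | .ind, k => .ind k

theorem eigen_sort : ∀ (τ : Srt) (k : ℕ), (eigen τ k).sort = τ
  | .num, _ => rfl
  | .ind, _ => rfl

variable {L : Signature}

/-- Terms of sort `τ`; the bound variables are de Bruijn indices into the list `Γ` of sorts. -/
inductive Term (L : Signature) (Γ : List Srt) : Srt → Type where
  | bvar {τ : Srt} (i : Fin Γ.length) (h : Γ.get i = τ) : Term L Γ τ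
  | fvar {τ : Srt} (x : Var) (h : x.sort = τ) : Term L Γ τ
  | zero : Term L Γ .num
  | succ (t : Term L Γ .num) : Term L Γ .num
  | app {τ : Srt} (f : L.Fn) (h : L.cod f = τ)
      (args : ∀ i : Fin (L.dom f).length, Term L Γ ((L.dom f).get i)) : Term L Γ τ

/-- Formulas, with bound variables in `Γ`. -/
inductive Fml (L : Signature) : List Srt → Type where
  | atom {Γ : List Srt} (p : L.Pr)
      (args : ∀ i : Fin (L.par p).length, Term L Γ ((L.par p).get i)) : Fml L Γ
  | neg {Γ : List Srt} (A : Fml L Γ) : Fml L Γ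
  | and {Γ : List Srt} (A B : Fml L Γ) : Fml L Γ
  | or {Γ : List Srt} (A B : Fml L Γ) : Fml L Γ
  | imp {Γ : List Srt} (A B : Fml L Γ) : Fml L Γ
  | all {Γ : List Srt} (τ : Srt) (A : Fml L (τ :: Γ)) : Fml L Γ
  | ex {Γ : List Srt} (τ : Srt) (A : Fml L (τ :: Γ)) : Fml L Γ

/-- The numeral `s(s(⋯s(0)))`. -/
def numeral {Γ : List Srt} : ℕ → Term L Γ .num
  | 0 => .zero
  | k + 1 => .succ (numeral k)

/-- The term consisting of a free variable. -/
def Term.var {Γ : List Srt} (x : Var) : Term L Γ x.sort := .fvar x rfl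

/-- The eigenvariable of sort `τ` with number `k`, as a term. -/
def eigenTerm {Γ : List Srt} (τ : Srt) (k : ℕ) : Term L Γ τ := .fvar (eigen τ k) (eigen_sort τ k)

/-- Add one bound variable to the context. -/
def Term.weaken {Γ : List Srt} (ρ : Srt) : {τ : Srt} → Term L Γ τ → Term L (ρ :: Γ) τ
  | _, .bvar i h => .bvar i.succ h
  | _, .fvar x h => .fvar x h
  | _, .zero => .zero
  | _, .succ t => .succ (t.weaken ρ)
  | _, .app f h args => .app f h (fun i => (args i).weaken ρ)

/-- Simultaneous substitution for bound (`b`) and free (`θ`) variables. -/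
def Term.subst {Γ Δ : List Srt} (b : ∀ i : Fin Γ.length, Term L Δ (Γ.get i))
    (θ : ∀ x : Var, Term L Δ x.sort) : {τ : Srt} → Term L Γ τ → Term L Δ τ
  | _, .bvar i h => h ▸ b i
  | _, .fvar x h => h ▸ θ x
  | _, .zero => .zero
  | _, .succ t => .succ (t.subst b θ)
  | _, .app f h args => .app f h (fun i => (args i).subst b θ)

/-- Pass a substitution for bound variables under a quantifier. -/
def liftBound {Γ Δ : List Srt} (ρ : Srt) (b : ∀ i : Fin Γ.length, Term L Δ (Γ.get i)) :
    ∀ i : Fin (ρ :: Γ).length, Term L (ρ :: Δ) ((ρ :: Γ).get i) :=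
  Fin.cases (.bvar (Γ := ρ :: Δ) ⟨0, Nat.succ_pos _⟩ rfl) (fun i => (b i).weaken ρ)

/-- Simultaneous capture-free substitution in formulas. -/
def Fml.subst : {Γ Δ : List Srt} → (∀ i : Fin Γ.length, Term L Δ (Γ.get i)) →
    (∀ x : Var, Term L Δ x.sort) → Fml L Γ → Fml L Δ
  | _, _, b, θ, .atom p args => .atom p (fun i => (args i).subst b θ)
  | _, _, b, θ, .neg A => .neg (A.subst b θ)
  | _, _, b, θ, .and A B => .and (A.subst b θ) (B.subst b θ)
  | _, _, b, θ, .or A B => .or (A.subst b θ) (B.subst b θ)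
  | _, _, b, θ, .imp A B => .imp (A.subst b θ) (B.subst b θ)
  | _, _, b, θ, .all τ A => .all τ (A.subst (liftBound τ b) (fun x => (θ x).weaken τ))
  | _, _, b, θ, .ex τ A => .ex τ (A.subst (liftBound τ b) (fun x => (θ x).weaken τ))

/-- No bound variable has to be replaced. -/
def noBound {Δ : List Srt} : ∀ i : Fin ([] : List Srt).length, Term L Δ (([] : List Srt).get i) :=
  fun i => i.elim0

/-- Substitutions: assignments of closed-scope terms of the right sort to the free variables. -/
abbrev Subst (L : Signature) := ∀ x : Var, Term L [] x.sort

/-- The result `tθ` of applying a substitution to a term. -/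
def Term.inst (θ : Subst L) {τ : Srt} (t : Term L [] τ) : Term L [] τ := t.subst noBound θ

/-- The result `Aθ` of applying a substitution to a formula. -/
def Fml.inst (θ : Subst L) (A : Fml L []) : Fml L [] := A.subst noBound θ

/-- The instance `A(t)` of the body `A(x)` of a quantified formula. -/
def Fml.opened {τ : Srt} (A : Fml L [τ]) (t : Term L [] τ) : Fml L [] :=
  A.subst (Fin.cases (motive := fun i : Fin ([τ] : List Srt).length => Term L [] ([τ].get i)) t
    (fun i => i.elim0)) Term.var

/-- The free variable `x` occurs in the term. -/
def Term.Occurs (x : Var) {Γ : List Srt} : {τ : Srt} → Term L Γ τ → Prop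
  | _, .bvar _ _ => False
  | _, .fvar y _ => y = x
  | _, .zero => False
  | _, .succ t => t.Occurs x
  | _, .app _ _ args => ∃ i, (args i).Occurs x

/-- The free variable `x` occurs in the formula. -/
def Fml.Occurs (x : Var) : {Γ : List Srt} → Fml L Γ → Prop
  | _, .atom _ args => ∃ i, (args i).Occurs x
  | _, .neg A => A.Occurs x
  | _, .and A B => A.Occurs x ∨ B.Occurs x
  | _, .or A B => A.Occurs x ∨ B.Occurs x
  | _, .imp A B => A.Occurs x ∨ B.Occurs x
  | _, .all _ A => A.Occurs x
  | _, .ex _ A => A.Occurs x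

/-- No active and no internal parameter occurs in the term. -/
def Term.PassiveOnly {Γ : List Srt} {τ : Srt} (t : Term L Γ τ) : Prop :=
  ∀ k, ¬ t.Occurs (.active k) ∧ ¬ t.Occurs (.internal k)

/-- Schematic numeric terms: built from zero and successor and at most one numeric parameter,
without any other function symbol. -/
def Term.Schematic {Γ : List Srt} : {τ : Srt} → Term L Γ τ → Prop
  | _, .bvar _ _ => False
  | _, .fvar x _ => x.sort = .num
  | _, .zero => True
  | _, .succ t => t.Schematic
  | _, .app _ _ _ => False

/-- No defined symbol occurs in the term. -/
def Term.NoDefined {Γ : List Srt} : {τ : Srt} → Term L Γ τ → Prop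
  | _, .bvar _ _ => True
  | _, .fvar _ _ => True
  | _, .zero => True
  | _, .succ t => t.NoDefined
  | _, .app f _ args => f ∉ L.DefFn ∧ ∀ i, (args i).NoDefined

/-! ## The equational theory -/

/-- A set of rewrite rules for the defined symbols. In a rule, the free variables play the role of
the variables of the rule, i.e. every substitution instance of a rule may be applied. -/
structure RewriteSystem (L : Signature) where
  tm : {τ : Srt} → Term L [] τ → Term L [] τ → Prop
  fm : Fml L [] → Fml L [] → Prop
  tm_lhs : ∀ {τ : Srt} (l r : Term L [] τ), tm l r →
    ∃ f, f ∈ L.DefFn ∧ ∃ h args, (∀ i, (args i).NoDefined) ∧ l = .app f h args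
  fm_lhs : ∀ l r : Fml L [], fm l r →
    ∃ p, p ∈ L.DefPr ∧ ∃ args, (∀ i, (args i).NoDefined) ∧ l = .atom p args

/-- One rewrite step inside a term. -/
inductive TermStep (E : RewriteSystem L) {Γ : List Srt} :
    {τ : Srt} → Term L Γ τ → Term L Γ τ → Prop where
  | rule {τ : Srt} (l r : Term L [] τ) (θ : ∀ x : Var, Term L Γ x.sort) (h : E.tm l r) :
      TermStep E (l.subst noBound θ) (r.subst noBound θ)
  | succ (t t' : Term L Γ .num) (h : TermStep E t t') : TermStep E (.succ t) (.succ t')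
  | app {τ : Srt} (f : L.Fn) (e : L.cod f = τ)
      (args : ∀ i : Fin (L.dom f).length, Term L Γ ((L.dom f).get i))
      (i : Fin (L.dom f).length) (t : Term L Γ ((L.dom f).get i)) (h : TermStep E (args i) t) :
      TermStep E (.app f e args) (.app f e (Function.update args i t))

/-- One rewrite step inside a formula. -/
inductive FmlStep (E : RewriteSystem L) : {Γ : List Srt} → Fml L Γ → Fml L Γ → Prop where
  | rule {Γ : List Srt} (l r : Fml L []) (θ : ∀ x : Var, Term L Γ x.sort) (h : E.fm l r) :
      FmlStep E (l.subst noBound θ) (r.subst noBound θ)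
  | atom {Γ : List Srt} (p : L.Pr)
      (args : ∀ i : Fin (L.par p).length, Term L Γ ((L.par p).get i))
      (i : Fin (L.par p).length) (t : Term L Γ ((L.par p).get i)) (h : TermStep E (args i) t) :
      FmlStep E (.atom p args) (.atom p (Function.update args i t))
  | neg {Γ : List Srt} (A A' : Fml L Γ) (h : FmlStep E A A') : FmlStep E (.neg A) (.neg A')
  | andL {Γ : List Srt} (A A' B : Fml L Γ) (h : FmlStep E A A') :
      FmlStep E (.and A B) (.and A' B)
  | andR {Γ : List Srt} (A B B' : Fml L Γ) (h : FmlStep E B B') :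
      FmlStep E (.and A B) (.and A B')
  | orL {Γ : List Srt} (A A' B : Fml L Γ) (h : FmlStep E A A') : FmlStep E (.or A B) (.or A' B)
  | orR {Γ : List Srt} (A B B' : Fml L Γ) (h : FmlStep E B B') : FmlStep E (.or A B) (.or A B')
  | impL {Γ : List Srt} (A A' B : Fml L Γ) (h : FmlStep E A A') :
      FmlStep E (.imp A B) (.imp A' B)
  | impR {Γ : List Srt} (A B B' : Fml L Γ) (h : FmlStep E B B') :
      FmlStep E (.imp A B) (.imp A B')
  | all {Γ : List Srt} (τ : Srt) (A A' : Fml L (τ :: Γ)) (h : FmlStep E A A') :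
      FmlStep E (.all τ A) (.all τ A')
  | ex {Γ : List Srt} (τ : Srt) (A A' : Fml L (τ :: Γ)) (h : FmlStep E A A') :
      FmlStep E (.ex τ A) (.ex τ A')

/-- A relation is convergent if it is terminating and confluent. -/
def ConvergentRel {α : Type} (r : α → α → Prop) : Prop :=
  WellFounded (fun b a => r a b) ∧
    ∀ a b c, Relation.ReflTransGen r a b → Relation.ReflTransGen r a c →
      Relation.Join (Relation.ReflTransGen r) b c

/-- The rewrite system is convergent, on terms and on formulas. -/
def RewriteSystem.Convergent (E : RewriteSystem L) : Prop :=
  (∀ (Γ : List Srt) (τ : Srt), ConvergentRel (TermStep E (Γ := Γ) (τ := τ))) ∧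
    ∀ Γ : List Srt, ConvergentRel (FmlStep E (Γ := Γ))

/-- Equality of formulas modulo the equational theory: the rules may be applied anywhere and in
both directions. -/
def EqFml (E : RewriteSystem L) : Fml L [] → Fml L [] → Prop := Relation.EqvGen (FmlStep E)

/-- The two formulas have a common normal form. -/
def SameNormalForm (E : RewriteSystem L) (A B : Fml L []) : Prop :=
  ∃ C, Relation.ReflTransGen (FmlStep E) A C ∧ Relation.ReflTransGen (FmlStep E) B C ∧
    ∀ D, ¬ FmlStep E C D

/-! ## Sequents and the inference rules -/

/-- A sequent is a pair of multisets of formulas. -/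
structure Sequent (L : Signature) where
  ant : Multiset (Fml L [])
  suc : Multiset (Fml L [])

/-- The result `Sθ` of applying a substitution to a sequent. -/
def Sequent.inst (θ : Subst L) (S : Sequent L) : Sequent L :=
  ⟨S.ant.map (Fml.inst θ), S.suc.map (Fml.inst θ)⟩

/-- The free variable `x` occurs in the sequent. -/
def Sequent.Occurs (x : Var) (S : Sequent L) : Prop :=
  (∃ A ∈ S.ant, A.Occurs x) ∨ ∃ A ∈ S.suc, A.Occurs x

/-- Extend a relation between formulas to sequents, formula by formula. -/
def SequentRel (r : Fml L [] → Fml L [] → Prop) (S S' : Sequent L) : Prop :=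
  Multiset.Rel r S.ant S'.ant ∧ Multiset.Rel r S.suc S'.suc

/-- Axiom schemes: sets of sequents closed under substitution. -/
def SubstClosed (Ax : Set (Sequent L)) : Prop := ∀ S ∈ Ax, ∀ θ : Subst L, S.inst θ ∈ Ax

/-- Initial sequents: `A ⊢ A` and the nonlogical axioms. -/
def Initial (Ax : Set (Sequent L)) (S : Sequent L) : Prop :=
  (∃ A, S = ⟨{A}, {A}⟩) ∨ S ∈ Ax

/-- Unary inferences of LK without eigenvariables. Terms containing active or internal parameters
cannot be quantified. -/
inductive Unary : Sequent L → Sequent L → Prop where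
  | weakL (Γ Δ : Multiset (Fml L [])) (A : Fml L []) : Unary ⟨Γ, Δ⟩ ⟨A ::ₘ Γ, Δ⟩
  | weakR (Γ Δ : Multiset (Fml L [])) (A : Fml L []) : Unary ⟨Γ, Δ⟩ ⟨Γ, A ::ₘ Δ⟩
  | contrL (Γ Δ : Multiset (Fml L [])) (A : Fml L []) :
      Unary ⟨A ::ₘ A ::ₘ Γ, Δ⟩ ⟨A ::ₘ Γ, Δ⟩
  | contrR (Γ Δ : Multiset (Fml L [])) (A : Fml L []) :
      Unary ⟨Γ, A ::ₘ A ::ₘ Δ⟩ ⟨Γ, A ::ₘ Δ⟩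
  | negL (Γ Δ : Multiset (Fml L [])) (A : Fml L []) : Unary ⟨Γ, A ::ₘ Δ⟩ ⟨.neg A ::ₘ Γ, Δ⟩
  | negR (Γ Δ : Multiset (Fml L [])) (A : Fml L []) : Unary ⟨A ::ₘ Γ, Δ⟩ ⟨Γ, .neg A ::ₘ Δ⟩
  | andL₁ (Γ Δ : Multiset (Fml L [])) (A B : Fml L []) :
      Unary ⟨A ::ₘ Γ, Δ⟩ ⟨.and A B ::ₘ Γ, Δ⟩
  | andL₂ (Γ Δ : Multiset (Fml L [])) (A B : Fml L []) :
      Unary ⟨B ::ₘ Γ, Δ⟩ ⟨.and A B ::ₘ Γ, Δ⟩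
  | orR₁ (Γ Δ : Multiset (Fml L [])) (A B : Fml L []) :
      Unary ⟨Γ, A ::ₘ Δ⟩ ⟨Γ, .or A B ::ₘ Δ⟩
  | orR₂ (Γ Δ : Multiset (Fml L [])) (A B : Fml L []) :
      Unary ⟨Γ, B ::ₘ Δ⟩ ⟨Γ, .or A B ::ₘ Δ⟩
  | impR (Γ Δ : Multiset (Fml L [])) (A B : Fml L []) :
      Unary ⟨A ::ₘ Γ, B ::ₘ Δ⟩ ⟨Γ, .imp A B ::ₘ Δ⟩
  | allL (Γ Δ : Multiset (Fml L [])) (τ : Srt) (A : Fml L [τ]) (t : Term L [] τ)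
      (ht : t.PassiveOnly) : Unary ⟨A.opened t ::ₘ Γ, Δ⟩ ⟨.all τ A ::ₘ Γ, Δ⟩
  | exR (Γ Δ : Multiset (Fml L [])) (τ : Srt) (A : Fml L [τ]) (t : Term L [] τ)
      (ht : t.PassiveOnly) : Unary ⟨Γ, A.opened t ::ₘ Δ⟩ ⟨Γ, .ex τ A ::ₘ Δ⟩

/-- Binary inferences of LK. -/
inductive Binary : Sequent L → Sequent L → Sequent L → Prop where
  | cut (Γ Δ Γ' Δ' : Multiset (Fml L [])) (A : Fml L []) :
      Binary ⟨Γ, A ::ₘ Δ⟩ ⟨A ::ₘ Γ', Δ'⟩ ⟨Γ + Γ', Δ + Δ'⟩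
  | andR (Γ Δ : Multiset (Fml L [])) (A B : Fml L []) :
      Binary ⟨Γ, A ::ₘ Δ⟩ ⟨Γ, B ::ₘ Δ⟩ ⟨Γ, .and A B ::ₘ Δ⟩
  | orL (Γ Δ : Multiset (Fml L [])) (A B : Fml L []) :
      Binary ⟨A ::ₘ Γ, Δ⟩ ⟨B ::ₘ Γ, Δ⟩ ⟨.or A B ::ₘ Γ, Δ⟩
  | impL (Γ Δ Γ' Δ' : Multiset (Fml L [])) (A B : Fml L []) :
      Binary ⟨Γ, A ::ₘ Δ⟩ ⟨B ::ₘ Γ', Δ'⟩ ⟨.imp A B ::ₘ (Γ + Γ'), Δ + Δ'⟩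

/-- Strong quantifier inferences with the eigenvariable of sort `τ` and number `k`, which must not
occur in the conclusion. -/
inductive Strong (τ : Srt) (k : ℕ) : Sequent L → Sequent L → Prop where
  | allR (Γ Δ : Multiset (Fml L [])) (A : Fml L [τ])
      (h : ¬ Sequent.Occurs (eigen τ k) ⟨Γ, .all τ A ::ₘ Δ⟩) :
      Strong τ k ⟨Γ, A.opened (eigenTerm τ k) ::ₘ Δ⟩ ⟨Γ, .all τ A ::ₘ Δ⟩
  | exL (Γ Δ : Multiset (Fml L [])) (A : Fml L [τ])
      (h : ¬ Sequent.Occurs (eigen τ k) ⟨.ex τ A ::ₘ Γ, Δ⟩) :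
      Strong τ k ⟨A.opened (eigenTerm τ k) ::ₘ Γ, Δ⟩ ⟨.ex τ A ::ₘ Γ, Δ⟩

/-! ## Derivation trees -/

/-- Trees of sequents; every node carries its sequent. Proof symbols are natural numbers. A leaf
`link S ψ θ` is the proof link to the symbol `ψ` with associated sequent `S`; the substitution `θ`
lists the arguments of the link, i.e. what it passes for the parameters (and the individual
variables) of the component named `ψ`. A node `conv` is an inference of the equational theory. -/
inductive Tree (L : Signature) where
  | init (S : Sequent L)
  | link (S : Sequent L) (ψ : ℕ) (θ : Subst L)
  | unary (S : Sequent L) (p : Tree L)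
  | conv (S : Sequent L) (p : Tree L)
  | binary (S : Sequent L) (p q : Tree L)
  | strong (S : Sequent L) (τ : Srt) (k : ℕ) (p : Tree L)

/-- The end-sequent. -/
def Tree.concl : Tree L → Sequent L
  | .init S => S
  | .link S _ _ => S
  | .unary S _ => S
  | .conv S _ => S
  | .binary S _ _ => S
  | .strong S _ _ _ => S

/-- Every inference of the tree is correct, where `Leaf` says which initial sequents, `LinkLeaf`
which sequents of links, and `Eqv` which inferences of the equational theory are admitted. -/
def Tree.Correct (Leaf LinkLeaf : Sequent L → Prop) (Eqv : Sequent L → Sequent L → Prop) :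
    Tree L → Prop
  | .init S => Leaf S
  | .link S _ _ => LinkLeaf S
  | .unary S p => p.Correct Leaf LinkLeaf Eqv ∧ Unary p.concl S
  | .conv S p => p.Correct Leaf LinkLeaf Eqv ∧ Eqv p.concl S
  | .binary S p q => p.Correct Leaf LinkLeaf Eqv ∧ q.Correct Leaf LinkLeaf Eqv ∧
      Binary p.concl q.concl S
  | .strong S τ k p => p.Correct Leaf LinkLeaf Eqv ∧ Strong τ k p.concl S

/-- The variable occurs in the tree: in one of its sequents, as an eigenvariable, or in an argument
of a link. (Links leave the passive parameters alone, so the values of a link at passive parameters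
are no arguments.) -/
def Tree.Occurs (x : Var) : Tree L → Prop
  | .init S => S.Occurs x
  | .link S _ θ => S.Occurs x ∨ ∃ y : Var, (∀ k, y ≠ .passive k) ∧ (θ y).Occurs x
  | .unary S p => S.Occurs x ∨ p.Occurs x
  | .conv S p => S.Occurs x ∨ p.Occurs x
  | .binary S p q => S.Occurs x ∨ p.Occurs x ∨ q.Occurs x
  | .strong S τ k p => S.Occurs x ∨ eigen τ k = x ∨ p.Occurs x

/-- The passive parameter number `k` is the eigenvariable of some inference of the tree. -/
def Tree.UsesEigen (k : ℕ) : Tree L → Prop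
  | .init _ => False
  | .link _ _ _ => False
  | .unary _ p => p.UsesEigen k
  | .conv _ p => p.UsesEigen k
  | .binary _ p q => p.UsesEigen k ∨ q.UsesEigen k
  | .strong _ τ j p => eigen τ j = .passive k ∨ p.UsesEigen k

/-- `link S ψ θ` is a leaf of the tree. -/
def Tree.HasLink (S : Sequent L) (ψ : ℕ) (θ : Subst L) : Tree L → Prop
  | .init _ => False
  | .link S' ψ' θ' => S' = S ∧ ψ' = ψ ∧ θ' = θ
  | .unary _ p => p.HasLink S ψ θ
  | .conv _ p => p.HasLink S ψ θ
  | .binary _ p q => p.HasLink S ψ θ ∨ q.HasLink S ψ θ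
  | .strong _ _ _ p => p.HasLink S ψ θ

open Classical in
/-- A number of an eigenvariable of sort `τ` that does not occur in `S`: the number `k` if it will
do, otherwise the least one. -/
noncomputable def freshFor (S : Sequent L) (τ : Srt) (k : ℕ) : ℕ :=
  if S.Occurs (eigen τ k) then sInf {j | ¬ S.Occurs (eigen τ j)} else k

/-- Change the value of a substitution at one variable. -/
def Subst.set (θ : Subst L) (x : Var) (t : Term L [] x.sort) : Subst L := Function.update θ x t

/-- Capture-avoiding substitution in trees: eigenvariables are bound by their inferences and are
renamed if necessary. -/
noncomputable def Tree.inst : Subst L → Tree L → Tree L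
  | θ, .init S => .init (S.inst θ)
  | θ, .link S ψ ρ => .link (S.inst θ) ψ (fun x => (ρ x).inst θ)
  | θ, .unary S p => .unary (S.inst θ) (p.inst θ)
  | θ, .conv S p => .conv (S.inst θ) (p.inst θ)
  | θ, .binary S p q => .binary (S.inst θ) (p.inst θ) (q.inst θ)
  | θ, .strong S τ k p => .strong (S.inst θ) τ (freshFor (S.inst θ) τ k)
      (p.inst (θ.set (eigen τ k)
        ((eigen_sort τ k).symm ▸ eigenTerm τ (freshFor (S.inst θ) τ k))))

/-! ## Components and P-schemata -/

/-- The tree is a derivation of the schematic calculus: initial sequents, the inferences of LK, the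
inferences of the equational theory, and links with arbitrary sequents at the leaves. -/
def IsDerivation (E : RewriteSystem L) (Ax : Set (Sequent L)) (d : Tree L) : Prop :=
  d.Correct (Initial Ax) (fun _ => True) (SequentRel (EqFml E))

/-- The data of a component `(ψ, π, ν)`: its proof symbol `name`, its active parameter number
`act`, its end-sequent `es`, the derivation `base = π` and the derivation `step = ν`. -/
structure Component (L : Signature) where
  name : ℕ
  act : ℕ
  es : Sequent L
  base : Tree L
  step : Tree L

/-- The substitution that replaces the active parameter number `n` by a numeric term. -/
def replaceActive (n : ℕ) (t : Term L [] .num) : Subst L := Subst.set Term.var (.active n) t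

/-- The link `link S ψ θ` occurs in the component. -/
def Component.HasLink (C : Component L) (S : Sequent L) (ψ : ℕ) (θ : Subst L) : Prop :=
  C.base.HasLink S ψ θ ∨ C.step.HasLink S ψ θ

/-- `C` is an `(n, I)`-component with `n = C.act` and `I` the set of internal parameters of its
end-sequent `S = C.es`: `π` is an inactive derivation of `S{n ← 0}`, and `ν` is an `{n}`-active
derivation of `S{n ← s(n)}`. -/
structure Component.IsComponent (E : RewriteSystem L) (Ax : Set (Sequent L)) (C : Component L) :
    Prop where
  es_active : ∀ k, C.es.Occurs (.active k) → k = C.act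
  base_derivation : IsDerivation E Ax C.base
  base_concl : C.base.concl = C.es.inst (replaceActive C.act .zero)
  base_inactive : ∀ k, ¬ C.base.Occurs (.active k)
  step_derivation : IsDerivation E Ax C.step
  step_concl : C.step.concl = C.es.inst (replaceActive C.act (.succ (Term.var (.active C.act))))
  step_active : ∀ k, C.step.Occurs (.active k) → k = C.act

/-- `(C, D)`-linkability: for each sequent `S` in `C` that is associated with a link to `D`, the
passive parameters of the end-sequent of `D` occur in `S`. -/
def Linkable (C D : Component L) : Prop :=
  ∀ S θ, C.HasLink S D.name θ → ∀ k, D.es.Occurs (.passive k) → S.Occurs (.passive k)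

/-- `link S D.name θ` is a link to `D`: its sequent is the instance of the end-sequent of `D` in
which the active and the internal parameters are replaced by schematic numeric terms (and
individual variables by individual terms), the passive parameters staying as they are. If `D` has
no active parameter in its end-sequent, then there is nothing to be passed for it, and the term
that `θ` holds in its place must not contain other kinds of parameters. -/
structure IsLinkTo (D : Component L) (S : Sequent L) (θ : Subst L) : Prop where
  sequent : S = D.es.inst θ
  passive : ∀ k, θ (.passive k) = Term.var (.passive k)
  active_schematic : ∀ k, (θ (.active k)).Schematic
  internal_schematic : ∀ k, (θ (.internal k)).Schematic
  no_active : ¬ D.es.Occurs (.active D.act) →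
    ∀ k, ¬ (θ (.active D.act)).Occurs (.passive k) ∧ ¬ (θ (.active D.act)).Occurs (.internal k)

/-- A `P`-schema `⟨C₁, …, C_α⟩` (with `α = len + 1`, and `C₁ = comp 0`): components with distinct
proof symbols and with passive parameters in `P`, together with a (well-founded) strict order `lt`
on them that is contained in the linkability ordering and has `C₁` as least element. All links lead
to components of the schema: a link to another component goes upwards in the order; a link of a
component to itself occurs only in its step case and recurses on the predecessor, i.e. passes the
active parameter `n` itself for `n`. -/
structure PSchema (E : RewriteSystem L) (Ax : Set (Sequent L)) (P : Set ℕ) where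
  len : ℕ
  comp : Fin (len + 1) → Component L
  isComponent : ∀ i, (comp i).IsComponent E Ax
  name_injective : Function.Injective fun i => (comp i).name
  passive_es : ∀ i k, (comp i).es.Occurs (.passive k) → k ∈ P
  passive_base : ∀ i k, (comp i).base.Occurs (.passive k) → k ∈ P
  passive_step : ∀ i k, (comp i).step.Occurs (.passive k) → k ∈ P
  lt : Fin (len + 1) → Fin (len + 1) → Prop
  lt_irrefl : ∀ i, ¬ lt i i
  lt_trans : ∀ i j k, lt i j → lt j k → lt i k
  lt_linkable : ∀ i j, lt i j → Linkable (comp i) (comp j)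
  lt_least : ∀ i, i ≠ 0 → lt 0 i
  link_target : ∀ i S ψ θ, (comp i).HasLink S ψ θ →
    ∃ j, (comp j).name = ψ ∧ IsLinkTo (comp j) S θ ∧ (j = i ∨ lt i j)
  self_base : ∀ i S θ, ¬ (comp i).base.HasLink S (comp i).name θ
  self_step : ∀ i S θ, (comp i).step.HasLink S (comp i).name θ →
    θ (.active (comp i).act) = Term.var (.active (comp i).act)

variable {E : RewriteSystem L} {Ax : Set (Sequent L)} {P : Set ℕ}

/-- The end-sequent of a `P`-schema is the one of its first component. -/
def PSchema.es (Ψ : PSchema E Ax P) : Sequent L := (Ψ.comp 0).es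

/-- The passive parameter number `k` is used as an eigenvariable in the schema. -/
def PSchema.UsesEigen (Ψ : PSchema E Ax P) (k : ℕ) : Prop :=
  ∃ i, (Ψ.comp i).base.UsesEigen k ∨ (Ψ.comp i).step.UsesEigen k

/-- A numeric term `t` in a proof of component `i` is *computational* if it contains a passive
parameter used as an eigenvariable, directly or through an internal parameter for which some link
to component `i` passes a computational term. -/
inductive PSchema.ComputationalTerm (Ψ : PSchema E Ax P) :
    Fin (Ψ.len + 1) → Term L [] .num → Prop where
  | passive (i : Fin (Ψ.len + 1)) (t : Term L [] .num) (k : ℕ) (hk : Ψ.UsesEigen k)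
      (ht : t.Occurs (.passive k)) : ComputationalTerm Ψ i t
  | internal (i j : Fin (Ψ.len + 1)) (t : Term L [] .num) (m : ℕ) (ht : t.Occurs (.internal m))
      (S : Sequent L) (θ : Subst L) (hθ : (Ψ.comp j).HasLink S (Ψ.comp i).name θ)
      (hc : ComputationalTerm Ψ j (θ (.internal m))) : ComputationalTerm Ψ i t

/-- A sub-schema of `Ψ`: a set of components of `Ψ` that is itself a schema with respect to the
order of `Ψ`, i.e. it is closed under links and has a least component. -/
structure PSchema.SubSchema (Ψ : PSchema E Ax P) where
  carrier : Set (Fin (Ψ.len + 1))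
  root : Fin (Ψ.len + 1)
  root_mem : root ∈ carrier
  root_least : ∀ i ∈ carrier, i ≠ root → Ψ.lt root i
  closed : ∀ i ∈ carrier, ∀ j S θ, (Ψ.comp i).HasLink S (Ψ.comp j).name θ → j ∈ carrier

/-- The end-sequent of a sub-schema. -/
def PSchema.SubSchema.es {Ψ : PSchema E Ax P} (Φ : Ψ.SubSchema) : Sequent L :=
  (Ψ.comp Φ.root).es

/-- The number of the active parameter of the end-sequent of a sub-schema. -/
def PSchema.SubSchema.act {Ψ : PSchema E Ax P} (Φ : Ψ.SubSchema) : ℕ := (Ψ.comp Φ.root).act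

/-- A sub-schema is computational if some link of `Ψ` to it replaces the active parameter of its
end-sequent by a computational term (in particular, by a term that is not ground). -/
def PSchema.SubSchema.Computational {Ψ : PSchema E Ax P} (Φ : Ψ.SubSchema) : Prop :=
  ∃ i S θ, (Ψ.comp i).HasLink S (Ψ.comp Φ.root).name θ ∧
    Ψ.ComputationalTerm i (θ (.active Φ.act))

/-- The theory `T` of a schema: the end-sequents of its computational sub-schemata, with the active
parameter replaced by a non-ground schematic term over passive parameters, the other numeric
parameters by schematic terms over passive parameters, and individual variables by terms without
active and internal parameters. -/
def PSchema.theory (Ψ : PSchema E Ax P) : Set (Sequent L) :=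
  {S | ∃ Φ : Ψ.SubSchema, Φ.Computational ∧ ∃ θ : Subst L,
    (∀ x, (θ x).PassiveOnly) ∧ (∀ x : Var, x.sort = .num → (θ x).Schematic) ∧
    (∃ k, (θ (.active Φ.act)).Occurs (.passive k)) ∧ S = Φ.es.inst θ}

/-! ## Evaluation -/

/-- One step of the rewrite system for links, anywhere in a tree: a link to a component whose active
parameter is instantiated by the numeral `0` is replaced by (the instance of) `π`, one whose active
parameter is instantiated by the numeral `s(k)` by (the instance of) `ν` with `k` for the active
parameter. -/
inductive PSchema.LinkStep (Ψ : PSchema E Ax P) : Tree L → Tree L → Prop where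
  | zero (i : Fin (Ψ.len + 1)) (S : Sequent L) (θ : Subst L)
      (h : θ (.active (Ψ.comp i).act) = numeral 0) :
      LinkStep Ψ (.link S (Ψ.comp i).name θ) ((Ψ.comp i).base.inst θ)
  | succ (i : Fin (Ψ.len + 1)) (S : Sequent L) (θ : Subst L) (k : ℕ)
      (h : θ (.active (Ψ.comp i).act) = numeral (k + 1)) :
      LinkStep Ψ (.link S (Ψ.comp i).name θ)
        ((Ψ.comp i).step.inst (θ.set (.active (Ψ.comp i).act) (numeral k)))
  | unary (S : Sequent L) (p p' : Tree L) (h : LinkStep Ψ p p') :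
      LinkStep Ψ (.unary S p) (.unary S p')
  | conv (S : Sequent L) (p p' : Tree L) (h : LinkStep Ψ p p') :
      LinkStep Ψ (.conv S p) (.conv S p')
  | binaryL (S : Sequent L) (p p' q : Tree L) (h : LinkStep Ψ p p') :
      LinkStep Ψ (.binary S p q) (.binary S p' q)
  | binaryR (S : Sequent L) (p q q' : Tree L) (h : LinkStep Ψ q q') :
      LinkStep Ψ (.binary S p q) (.binary S p q')
  | strong (S : Sequent L) (τ : Srt) (k : ℕ) (p p' : Tree L) (h : LinkStep Ψ p p') :
      LinkStep Ψ (.strong S τ k p) (.strong S τ k p')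

/-- `d'` is a normal form of `d` with respect to the rewrite system for links. -/
def PSchema.IsNormalForm (Ψ : PSchema E Ax P) (d d' : Tree L) : Prop :=
  Relation.ReflTransGen Ψ.LinkStep d d' ∧ ∀ d'', ¬ Ψ.LinkStep d' d''

/-- The substitution of numerals given by `σ` on passive, `μ` on internal and `a` on active
parameters; individual variables stay. -/
def numeralSubst (σ μ a : ℕ → ℕ) : Subst L
  | .active k => numeral (a k)
  | .passive k => numeral (σ k)
  | .internal k => numeral (μ k)
  | .ind k => Term.var (.ind k)

/-- The substitution of numerals for the passive parameters only. -/
def passiveSubst (σ : ℕ → ℕ) : Subst L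
  | .passive k => numeral (σ k)
  | .active k => Term.var (.active k)
  | .internal k => Term.var (.internal k)
  | .ind k => Term.var (.ind k)

/-- The initial expression of the evaluation: the link to the first component, under the given
substitution of numerals. -/
def PSchema.start (Ψ : PSchema E Ax P) (σ μ a : ℕ → ℕ) : Tree L :=
  .link (Ψ.es.inst (numeralSubst σ μ a)) (Ψ.comp 0).name (numeralSubst σ μ a)

/-- `d` is an LK-proof over the theory `T`: no active and no internal parameters occur in it, its
leaves are initial sequents or (sequents of unevaluated links that are) axioms in `T`, its
inferences are those of LK and trivial inferences of the equational theory, i.e. premise and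
conclusion are the same up to normal forms. -/
def IsLKProofOver (E : RewriteSystem L) (Ax T : Set (Sequent L)) (d : Tree L) : Prop :=
  d.Correct (Initial Ax) (fun S => S ∈ T) (SequentRel (SameNormalForm E)) ∧
    ∀ k, ¬ d.Occurs (.active k) ∧ ¬ d.Occurs (.internal k)

end PSchemata

namespace PSchemata

variable {L : Signature}

/-! ## Substitution -/

/-! Uniqueness is confluence. Links are leaves, and a given link can be unfolded in only one way, so
reduction has a one-step diamond property (`PSchema.LinkStep.diamond`) and Church–Rosser applies.

Existence does not need strong normalisation: it suffices to reach one normal form and check that it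
is a proof. This is a double induction (`PSchema.Admissible.evaluates`). The outer one runs down the
order of the components from the maximal ones, since links to other components go up. The inner one
is on the numeral passed for the active parameter: a self-link occurs only in the step case, where
it passes the predecessor. Between links, LK inferences survive substitution once eigenvariables are
renamed (`Strong.inst`), and convergence makes every instance of an equational inference trivial
(`SequentRel.sameNormalForm_inst`).

Evaluation can get stuck only because an eigenvariable, kept or renamed, reaches an active argument.
The invariant `PSchema.Admissible` records where such a non-ground term can come from: a passive
parameter used as an eigenvariable, or a parameter for which some link passes a computational term.
The unfolded component has a numeral for its active parameter, so any passive parameter left in an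
argument of its links comes from one of the other sources, which makes that argument computational
(`PSchema.Admissible.computationalTerm`). Hence a stuck link leads to a computational sub-schema,
and its sequent is in the theory (`PSchema.Admissible.evaluates_of_occurs`). Any other active
argument is a numeral, and its link unfolds. -/

theorem Term.subst_weaken {Γ Δ : List Srt} (ρ : Srt) {b : ∀ i : Fin Γ.length, Term L Δ (Γ.get i)}
    {θ : ∀ x : Var, Term L Δ x.sort} {c : ∀ i : Fin (ρ :: Γ).length, Term L Δ ((ρ :: Γ).get i)}
    (hc : ∀ i : Fin Γ.length, c i.succ = b i) {τ : Srt} (t : Term L Γ τ) :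
    (t.weaken ρ).subst c θ = t.subst b θ := by
  induction t with
  | bvar i h => subst h; exact hc i
  | fvar x h => rfl
  | zero => rfl
  | succ t ih => simp only [Term.weaken, Term.subst, ih]
  | app f h args ih => simp only [Term.weaken, Term.subst, ih]

theorem Term.weaken_subst {Γ Δ : List Srt} (ρ : Srt) (b : ∀ i : Fin Γ.length, Term L Δ (Γ.get i))
    (θ : ∀ x : Var, Term L Δ x.sort) {τ : Srt} (t : Term L Γ τ) :
    (t.subst b θ).weaken ρ =
      t.subst (fun i => (b i).weaken ρ) (fun x => (θ x).weaken ρ) := by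
  induction t with
  | bvar i h => subst h; rfl
  | fvar x h => subst h; rfl
  | zero => rfl
  | succ t ih => simp only [Term.weaken, Term.subst, ih]
  | app f h args ih => simp only [Term.weaken, Term.subst, ih]

theorem Term.subst_subst {Γ Δ Θ : List Srt} (b : ∀ i : Fin Γ.length, Term L Δ (Γ.get i))
    (θ : ∀ x : Var, Term L Δ x.sort) (c : ∀ i : Fin Δ.length, Term L Θ (Δ.get i))
    (η : ∀ x : Var, Term L Θ x.sort) {τ : Srt} (t : Term L Γ τ) :
    (t.subst b θ).subst c η =
      t.subst (fun i => (b i).subst c η) (fun x => (θ x).subst c η) := by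
  induction t with
  | bvar i h => subst h; rfl
  | fvar x h => subst h; rfl
  | zero => rfl
  | succ t ih => simp only [Term.subst, ih]
  | app f h args ih => simp only [Term.subst, ih]

/-- The quantifier case of composing substitutions. Index zero is the new bound variable on both
sides; at a successor, weakening commutes with substitution. -/
theorem liftBound_subst {Γ Δ Θ : List Srt} (ρ : Srt)
    (b : ∀ i : Fin Γ.length, Term L Δ (Γ.get i)) (c : ∀ i : Fin Δ.length, Term L Θ (Δ.get i))
    (η : ∀ x : Var, Term L Θ x.sort) :
    (fun i => (liftBound ρ b i).subst (liftBound ρ c) (fun x => (η x).weaken ρ)) =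
      liftBound ρ (fun i => (b i).subst c η) := by
  funext i
  refine Fin.cases ?_ (fun i => ?_) i
  · rfl
  · exact (Term.subst_weaken ρ (fun _ => rfl) (b i)).trans (Term.weaken_subst ρ c η (b i)).symm

theorem Fml.subst_subst {Γ : List Srt} (A : Fml L Γ) : ∀ {Δ Θ : List Srt}
    (b : ∀ i : Fin Γ.length, Term L Δ (Γ.get i)) (θ : ∀ x : Var, Term L Δ x.sort)
    (c : ∀ i : Fin Δ.length, Term L Θ (Δ.get i)) (η : ∀ x : Var, Term L Θ x.sort),
    (A.subst b θ).subst c η =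
      A.subst (fun i => (b i).subst c η) (fun x => (θ x).subst c η) := by
  -- The counterpart of `liftBound_subst` for the values at free variables.
  have key : ∀ {Δ Θ : List Srt} (τ : Srt) (θ : ∀ x : Var, Term L Δ x.sort)
      (c : ∀ i : Fin Δ.length, Term L Θ (Δ.get i)) (η : ∀ x : Var, Term L Θ x.sort),
      (fun x => ((θ x).weaken τ).subst (liftBound τ c) (fun x => (η x).weaken τ)) =
        fun x => ((θ x).subst c η).weaken τ := fun τ θ c η => funext fun x =>
    (Term.subst_weaken τ (fun _ => rfl) (θ x)).trans (Term.weaken_subst τ c η (θ x)).symm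
  induction A with
  | atom p args => intros; simp only [Fml.subst, Term.subst_subst]
  | neg A ih => intros; simp only [Fml.subst, ih]
  | and A B ihA ihB => intros; simp only [Fml.subst, ihA, ihB]
  | or A B ihA ihB => intros; simp only [Fml.subst, ihA, ihB]
  | imp A B ihA ihB => intros; simp only [Fml.subst, ihA, ihB]
  | all τ A ih => intros; simp only [Fml.subst, ih, liftBound_subst, key]
  | ex τ A ih => intros; simp only [Fml.subst, ih, liftBound_subst, key]

theorem Term.subst_id {Γ : List Srt} {τ : Srt} (t : Term L Γ τ) :
    t.subst (fun i => .bvar i rfl) Term.var = t := by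
  induction t with
  | bvar i h => subst h; rfl
  | fvar x h => subst h; rfl
  | zero => rfl
  | succ t ih => simp only [Term.subst, ih]
  | app f h args ih => simp only [Term.subst, ih]

theorem noBound_eq {Δ : List Srt}
    (b : ∀ i : Fin ([] : List Srt).length, Term L Δ (([] : List Srt).get i)) : b = noBound :=
  funext fun i => i.elim0

theorem Term.inst_var {τ : Srt} (t : Term L [] τ) : t.subst noBound Term.var = t := by
  rw [← noBound_eq fun i => .bvar i rfl]; exact t.subst_id

theorem Term.subst_congr {Γ Δ : List Srt} (b : ∀ i : Fin Γ.length, Term L Δ (Γ.get i))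
    (θ θ' : ∀ x : Var, Term L Δ x.sort) {τ : Srt} (t : Term L Γ τ)
    (h : ∀ x, t.Occurs x → θ x = θ' x) : t.subst b θ = t.subst b θ' := by
  induction t with
  | bvar i h => rfl
  | fvar x e => subst e; exact h x rfl
  | zero => rfl
  | succ t ih => simp only [Term.subst, ih h]
  | app f e args ih =>
    simp only [Term.subst, fun i => ih i fun x hx => h x ⟨i, hx⟩]

theorem Fml.subst_congr {Γ : List Srt} (A : Fml L Γ) : ∀ {Δ : List Srt}
    (b : ∀ i : Fin Γ.length, Term L Δ (Γ.get i)) (θ θ' : ∀ x : Var, Term L Δ x.sort)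
    (_ : ∀ x, A.Occurs x → θ x = θ' x), A.subst b θ = A.subst b θ' := by
  induction A with
  | atom p args =>
    intro Δ b θ θ' h
    simp only [Fml.subst, fun i => Term.subst_congr b θ θ' (args i) fun x hx => h x ⟨i, hx⟩]
  | neg A ih => intro Δ b θ θ' h; simp only [Fml.subst, ih b θ θ' h]
  | and A B ihA ihB | or A B ihA ihB | imp A B ihA ihB =>
    intro Δ b θ θ' h
    simp only [Fml.subst, ihA b θ θ' fun x hx => h x (.inl hx),
      ihB b θ θ' fun x hx => h x (.inr hx)]
  | all τ A ih | ex τ A ih =>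
    intro Δ b θ θ' h
    simp only [Fml.subst,
      ih (liftBound τ b) (fun x => (θ x).weaken τ) (fun x => (θ' x).weaken τ)
        fun x hx => congrArg (Term.weaken τ) (h x hx)]

/-! ### Occurrences of free variables under substitution -/

theorem Term.occurs_weaken {Γ : List Srt} (ρ : Srt) {x : Var} {τ : Srt} (t : Term L Γ τ) :
    (t.weaken ρ).Occurs x ↔ t.Occurs x := by
  induction t with
  | bvar i h => rfl
  | fvar x e => rfl
  | zero => rfl
  | succ t ih => exact ih
  | app f e args ih => exact exists_congr ih

/-- Traces an occurrence in an instance back to the free variable whose value contains it; `hb`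
excludes the values of bound variables as another source. -/
theorem Term.occurs_subst {Γ Δ : List Srt} {b : ∀ i : Fin Γ.length, Term L Δ (Γ.get i)}
    {θ : ∀ x : Var, Term L Δ x.sort} {x : Var} (hb : ∀ i, ¬ (b i).Occurs x) {τ : Srt}
    (t : Term L Γ τ) (h : (t.subst b θ).Occurs x) : ∃ y, t.Occurs y ∧ (θ y).Occurs x := by
  induction t with
  | bvar i e => subst e; exact (hb i h).elim
  | fvar y e => subst e; exact ⟨y, rfl, h⟩
  | zero => exact h.elim
  | succ t ih => exact ih h
  | app f e args ih =>
    obtain ⟨i, hi⟩ := h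
    obtain ⟨y, hy, hx⟩ := ih i hi
    exact ⟨y, ⟨i, hy⟩, hx⟩

theorem liftBound_not_occurs {Γ Δ : List Srt} (ρ : Srt)
    {b : ∀ i : Fin Γ.length, Term L Δ (Γ.get i)} {x : Var} (hb : ∀ i, ¬ (b i).Occurs x) :
    ∀ i, ¬ (liftBound ρ b i).Occurs x :=
  Fin.cases (fun h => h.elim) fun i h => hb i ((Term.occurs_weaken ρ (b i)).1 h)

theorem Fml.occurs_subst {Γ : List Srt} (A : Fml L Γ) {x : Var} : ∀ {Δ : List Srt}
    {b : ∀ i : Fin Γ.length, Term L Δ (Γ.get i)} {θ : ∀ x : Var, Term L Δ x.sort}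
    (_ : ∀ i, ¬ (b i).Occurs x) (_ : (A.subst b θ).Occurs x),
    ∃ y, A.Occurs y ∧ (θ y).Occurs x := by
  induction A with
  | atom p args =>
    intro Δ b θ hb ⟨i, hi⟩
    obtain ⟨y, hy, hx⟩ := Term.occurs_subst hb (args i) hi
    exact ⟨y, ⟨i, hy⟩, hx⟩
  | neg A ih => intro Δ b θ hb h; exact ih hb h
  | and A B ihA ihB | or A B ihA ihB | imp A B ihA ihB =>
    intro Δ b θ hb h
    rcases h with h | h
    · obtain ⟨y, hy, hx⟩ := ihA hb h
      exact ⟨y, .inl hy, hx⟩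
    · obtain ⟨y, hy, hx⟩ := ihB hb h
      exact ⟨y, .inr hy, hx⟩
  | all τ A ih | ex τ A ih =>
    intro Δ b θ hb h
    obtain ⟨y, hy, hx⟩ := ih (liftBound_not_occurs τ hb) h
    exact ⟨y, hy, (Term.occurs_weaken τ _).1 hx⟩

theorem Term.occurs_inst {θ : Subst L} {x : Var} {τ : Srt} {t : Term L [] τ}
    (h : (t.inst θ).Occurs x) : ∃ y, t.Occurs y ∧ (θ y).Occurs x :=
  Term.occurs_subst (b := noBound) (fun i => i.elim0) t h

theorem Sequent.occurs_inst {θ : Subst L} {x : Var} {S : Sequent L}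
    (h : (S.inst θ).Occurs x) : ∃ y, S.Occurs y ∧ (θ y).Occurs x := by
  rcases h with ⟨A, hA, h⟩ | ⟨A, hA, h⟩ <;> obtain ⟨B, hB, rfl⟩ := Multiset.mem_map.1 hA <;>
    obtain ⟨y, hy, hx⟩ := Fml.occurs_subst B (b := noBound) (fun i => i.elim0) h
  exacts [⟨y, .inl ⟨B, hB, hy⟩, hx⟩, ⟨y, .inr ⟨B, hB, hy⟩, hx⟩]

/-- Composition of substitutions: first `θ`, then `η`. -/
def Subst.comp (θ η : Subst L) : Subst L := fun x => (θ x).inst η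

theorem Term.inst_inst (θ η : Subst L) {τ : Srt} (t : Term L [] τ) :
    (t.inst θ).inst η = t.inst (θ.comp η) := by
  unfold Term.inst; rw [Term.subst_subst, noBound_eq fun _ => _]; rfl

theorem Fml.inst_inst (θ η : Subst L) (A : Fml L []) :
    (A.inst θ).inst η = A.inst (θ.comp η) := by
  unfold Fml.inst; rw [Fml.subst_subst, noBound_eq fun _ => _]; rfl

theorem Sequent.inst_inst (θ η : Subst L) (S : Sequent L) :
    (S.inst θ).inst η = S.inst (θ.comp η) := by
  simp only [Sequent.inst, Multiset.map_map, Function.comp_def, Fml.inst_inst]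

theorem Sequent.inst_congr {θ η : Subst L} {S : Sequent L} (h : ∀ x, S.Occurs x → θ x = η x) :
    S.inst θ = S.inst η := by
  unfold Sequent.inst
  congr 1
  · exact Multiset.map_congr rfl fun A hA =>
      Fml.subst_congr A _ _ _ fun x hx => h x (.inl ⟨A, hA, hx⟩)
  · exact Multiset.map_congr rfl fun A hA =>
      Fml.subst_congr A _ _ _ fun x hx => h x (.inr ⟨A, hA, hx⟩)

/-- Apply a substitution to a formula with one free bound variable. -/
def Fml.instBody {τ : Srt} (θ : Subst L) (A : Fml L [τ]) : Fml L [τ] :=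
  A.subst (liftBound τ noBound) (fun x => (θ x).weaken τ)

/-- This carries the quantifier rules through a substitution: both sides compose to one
substitution, with `t.inst θ` for the bound variable and `θ` for the free ones. -/
theorem Fml.opened_inst {τ : Srt} (θ : Subst L) (A : Fml L [τ]) (t : Term L [] τ) :
    (A.opened t).inst θ = (A.instBody θ).opened (t.inst θ) := by
  unfold Fml.opened Fml.inst Fml.instBody
  rw [Fml.subst_subst, Fml.subst_subst]
  congr 1
  · funext i
    refine Fin.cases rfl (fun i => i.elim0) i
  · funext x
    -- A weakened value of `θ` does not contain the new bound variable, so opening leaves it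
    -- unchanged.
    exact ((Term.subst_weaken (b := noBound) τ (fun i => i.elim0) (θ x)).trans
      (θ x).inst_var).symm

/-! ### Supply of fresh eigenvariables -/

theorem Term.exists_bound_eigen {Γ : List Srt} (τ : Srt) {σ : Srt} (t : Term L Γ σ) :
    ∃ N, ∀ k, t.Occurs (eigen τ k) → k < N := by
  induction t with
  | bvar i h => exact ⟨0, fun k h => h.elim⟩
  | fvar x e =>
    by_cases hx : ∃ j, x = eigen τ j
    · obtain ⟨j, rfl⟩ := hx
      refine ⟨j + 1, fun k h => ?_⟩
      have h : eigen τ j = eigen τ k := h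
      cases τ <;> · simp only [eigen, Var.passive.injEq, Var.ind.injEq] at h; omega
    · exact ⟨0, fun k h => (hx ⟨k, h⟩).elim⟩
  | zero => exact ⟨0, fun k h => h.elim⟩
  | succ t ih => exact ih
  | app f e args ih =>
    choose N hN using ih
    exact ⟨Finset.univ.sup N, fun k ⟨i, hi⟩ =>
      (hN i k hi).trans_le (Finset.le_sup (Finset.mem_univ i))⟩

theorem Fml.exists_bound_eigen {Γ : List Srt} (τ : Srt) (A : Fml L Γ) :
    ∃ N, ∀ k, A.Occurs (eigen τ k) → k < N := by
  induction A with
  | atom p args =>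
    choose N hN using fun i => (args i).exists_bound_eigen τ
    exact ⟨Finset.univ.sup N, fun k ⟨i, hi⟩ =>
      (hN i k hi).trans_le (Finset.le_sup (Finset.mem_univ i))⟩
  | neg A ih => exact ih
  | and A B ihA ihB | or A B ihA ihB | imp A B ihA ihB =>
    obtain ⟨N, hN⟩ := ihA
    obtain ⟨M, hM⟩ := ihB
    exact ⟨max N M, fun k h => lt_max_iff.2 (h.imp (hN k) (hM k))⟩
  | all τ A ih | ex τ A ih => exact ih

theorem exists_bound_eigen_multiset (τ : Srt) (Γ : Multiset (Fml L [])) :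
    ∃ N, ∀ k, (∃ A ∈ Γ, A.Occurs (eigen τ k)) → k < N := by
  induction Γ using Multiset.induction with
  | empty => exact ⟨0, fun k ⟨A, hA, _⟩ => (Multiset.notMem_zero A hA).elim⟩
  | cons A Γ ih =>
    obtain ⟨N, hN⟩ := ih
    obtain ⟨M, hM⟩ := A.exists_bound_eigen τ
    refine ⟨max N M, fun k ⟨B, hB, h⟩ => lt_max_iff.2 ?_⟩
    rcases Multiset.mem_cons.1 hB with rfl | hB
    exacts [.inr (hM k h), .inl (hN k ⟨B, hB, h⟩)]

theorem freshFor_not_occurs (S : Sequent L) (τ : Srt) (k : ℕ) :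
    ¬ S.Occurs (eigen τ (freshFor S τ k)) := by
  unfold freshFor
  split_ifs with h
  · obtain ⟨N, hN⟩ := exists_bound_eigen_multiset τ S.ant
    obtain ⟨M, hM⟩ := exists_bound_eigen_multiset τ S.suc
    -- The infimum has the required property only if the set is nonempty; `max N M` exceeds every
    -- eigenvariable number of sort `τ` in either half of the sequent.
    refine Nat.sInf_mem (s := {j | ¬ S.Occurs (eigen τ j)}) ⟨max N M, fun h => ?_⟩
    rcases h with h | h
    · exact absurd (hN _ h) (by simp)
    · exact absurd (hM _ h) (by simp)
  · exact h

/-! ## The equational theory under substitution -/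

variable {E : RewriteSystem L}

theorem TermStep.subst {Γ Δ : List Srt} (b : ∀ i : Fin Γ.length, Term L Δ (Γ.get i))
    (η : ∀ x : Var, Term L Δ x.sort) {τ : Srt} {t t' : Term L Γ τ} (h : TermStep E t t') :
    TermStep E (t.subst b η) (t'.subst b η) := by
  induction h with
  | rule l r θ h =>
    -- An instance of an instance of a rule is again an instance of the rule.
    rw [Term.subst_subst, Term.subst_subst, noBound_eq fun _ => _]
    exact .rule l r _ h
  | succ t t' _ ih => exact .succ _ _ ih
  | app f e args i t _ ih =>
    simp only [Term.subst]
    convert TermStep.app f e (fun i => (args i).subst b η) i (t.subst b η) ih using 2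
    funext j
    rcases eq_or_ne j i with rfl | hj <;> simp [*]

theorem FmlStep.subst {Γ : List Srt} {A A' : Fml L Γ} (h : FmlStep E A A') :
    ∀ {Δ : List Srt} (b : ∀ i : Fin Γ.length, Term L Δ (Γ.get i))
      (η : ∀ x : Var, Term L Δ x.sort), FmlStep E (A.subst b η) (A'.subst b η) := by
  induction h with
  | rule l r θ h =>
    intro Δ b η
    rw [Fml.subst_subst, Fml.subst_subst, noBound_eq fun _ => _]
    exact .rule l r _ h
  | atom p args i t h =>
    intro Δ b η
    simp only [Fml.subst]
    convert FmlStep.atom p (fun i => (args i).subst b η) i (t.subst b η) (h.subst b η) using 2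
    funext j
    rcases eq_or_ne j i with rfl | hj <;> simp [*]
  | neg A A' _ ih => exact fun b η => .neg _ _ (ih b η)
  | andL A A' B _ ih => exact fun b η => .andL _ _ _ (ih b η)
  | andR A B B' _ ih => exact fun b η => .andR _ _ _ (ih b η)
  | orL A A' B _ ih => exact fun b η => .orL _ _ _ (ih b η)
  | orR A B B' _ ih => exact fun b η => .orR _ _ _ (ih b η)
  | impL A A' B _ ih => exact fun b η => .impL _ _ _ (ih b η)
  | impR A B B' _ ih => exact fun b η => .impR _ _ _ (ih b η)
  | all τ A A' _ ih => exact fun b η => .all _ _ _ (ih _ _)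
  | ex τ A A' _ ih => exact fun b η => .ex _ _ _ (ih _ _)

theorem EqFml.inst (θ : Subst L) {A B : Fml L []} (h : EqFml E A B) :
    EqFml E (A.inst θ) (B.inst θ) := by
  induction h with
  | rel A B h => exact .rel _ _ (h.subst _ _)
  | refl A => exact .refl _
  | symm A B _ ih => exact .symm _ _ ih
  | trans A B C _ _ ih ih' => exact .trans _ _ _ ih ih'

/-! ### Normal forms of convergent relations -/

theorem ConvergentRel.exists_normalForm {α : Type} {r : α → α → Prop} (h : ConvergentRel r)
    (a : α) : ∃ c, Relation.ReflTransGen r a c ∧ ∀ d, ¬ r c d := by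
  induction a using h.1.induction with
  | _ a ih =>
    by_cases ha : ∃ b, r a b
    · obtain ⟨b, hb⟩ := ha
      obtain ⟨c, hc, hn⟩ := ih b hb
      exact ⟨c, .head hb hc, hn⟩
    · exact ⟨a, .refl, fun d hd => ha ⟨d, hd⟩⟩

theorem eq_of_reflTransGen_of_normal {α : Type} {r : α → α → Prop} {a b : α}
    (h : Relation.ReflTransGen r a b) (ha : ∀ d, ¬ r a d) : a = b := by
  rcases Relation.ReflTransGen.cases_head h with h | ⟨c, hc, _⟩
  exacts [h, (ha c hc).elim]

/-- Termination supplies normal forms. Confluence is needed for transitivity: the middle element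
reaches two normal forms, which are joinable and hence equal. -/
theorem ConvergentRel.common_normalForm {α : Type} {r : α → α → Prop} (h : ConvergentRel r)
    {a b : α} (hab : Relation.EqvGen r a b) :
    ∃ c, Relation.ReflTransGen r a c ∧ Relation.ReflTransGen r b c ∧ ∀ d, ¬ r c d := by
  induction hab with
  | rel a b hab =>
    obtain ⟨c, hc, hn⟩ := h.exists_normalForm b
    exact ⟨c, .head hab hc, hc, hn⟩
  | refl a =>
    obtain ⟨c, hc, hn⟩ := h.exists_normalForm a
    exact ⟨c, hc, hc, hn⟩
  | symm a b _ ih =>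
    obtain ⟨c, ha, hb, hn⟩ := ih
    exact ⟨c, hb, ha, hn⟩
  | trans a b c _ _ ih ih' =>
    obtain ⟨d, ha, hb, hd⟩ := ih
    obtain ⟨d', hb', hc, hd'⟩ := ih'
    obtain ⟨e, he, he'⟩ := h.2 b d d' hb hb'
    obtain rfl := eq_of_reflTransGen_of_normal he hd
    obtain rfl := eq_of_reflTransGen_of_normal he' hd'
    exact ⟨_, ha, hc, hd⟩

/-- Equality modulo the rules, not normality, is stable under substitution; hence the formulas are
instantiated first and normalised afterwards. -/
theorem SequentRel.sameNormalForm_inst (hE : E.Convergent) (θ : Subst L) {S S' : Sequent L}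
    (h : SequentRel (EqFml E) S S') :
    SequentRel (SameNormalForm E) (S.inst θ) (S'.inst θ) := by
  have key : ∀ {A B : Fml L []}, EqFml E A B → SameNormalForm E (A.inst θ) (B.inst θ) :=
    fun h => (hE.2 []).common_normalForm (h.inst θ)
  exact ⟨Multiset.rel_map.2 (h.1.mono fun _ _ _ _ => key),
    Multiset.rel_map.2 (h.2.mono fun _ _ _ _ => key)⟩

/-! ## Inferences under substitution -/

theorem Initial.inst {Ax : Set (Sequent L)} (hAx : SubstClosed Ax) (θ : Subst L) {S : Sequent L}
    (h : Initial Ax S) : Initial Ax (S.inst θ) := by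
  rcases h with ⟨A, rfl⟩ | h
  · exact .inl ⟨A.inst θ, by simp [Sequent.inst]⟩
  · exact .inr (hAx S h θ)

theorem Term.PassiveOnly.inst {θ : Subst L} (hθ : ∀ x, (θ x).PassiveOnly) {τ : Srt}
    (t : Term L [] τ) : (t.inst θ).PassiveOnly := fun k =>
  ⟨fun h => let ⟨y, _, hy⟩ := Term.occurs_inst h; (hθ y k).1 hy,
    fun h => let ⟨y, _, hy⟩ := Term.occurs_inst h; (hθ y k).2 hy⟩

/-- The hypothesis on `θ` serves the weak quantifier rules, whose terms must stay free of active and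
internal parameters. -/
theorem Unary.inst {θ : Subst L} (hθ : ∀ x, (θ x).PassiveOnly) {S S' : Sequent L}
    (h : Unary S S') : Unary (S.inst θ) (S'.inst θ) := by
  cases h <;> simp only [Sequent.inst, Multiset.map_cons, Fml.opened_inst]
  case weakL => exact .weakL _ _ _
  case weakR => exact .weakR _ _ _
  case contrL => exact .contrL _ _ _
  case contrR => exact .contrR _ _ _
  case negL => exact .negL _ _ _
  case negR => exact .negR _ _ _
  case andL₁ => exact .andL₁ _ _ _ _
  case andL₂ => exact .andL₂ _ _ _ _
  case orR₁ => exact .orR₁ _ _ _ _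
  case orR₂ => exact .orR₂ _ _ _ _
  case impR => exact .impR _ _ _ _
  case allL => exact .allL _ _ _ _ _ (.inst hθ _)
  case exR => exact .exR _ _ _ _ _ (.inst hθ _)

theorem Binary.inst (θ : Subst L) {S S' S'' : Sequent L} (h : Binary S S' S'') :
    Binary (S.inst θ) (S'.inst θ) (S''.inst θ) := by
  cases h <;> simp only [Sequent.inst, Multiset.map_cons, Multiset.map_add]
  case cut => exact .cut _ _ _ _ _
  case andR => exact .andR _ _ _ _
  case orL => exact .orL _ _ _ _
  case impL => exact .impL _ _ _ _ _ _

/-- Change the value of `θ` at the eigenvariable of sort `τ` and number `k` to the eigenvariable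
with number `j`. -/
def Subst.rename (θ : Subst L) (τ : Srt) (k j : ℕ) : Subst L :=
  θ.set (eigen τ k) ((eigen_sort τ k).symm ▸ eigenTerm τ j)

theorem Subst.rename_of_ne (θ : Subst L) {τ : Srt} {k : ℕ} (j : ℕ) {x : Var}
    (hx : x ≠ eigen τ k) : θ.rename τ k j x = θ x :=
  Function.update_of_ne hx _ _

theorem eigenTerm_inst_rename (θ : Subst L) (τ : Srt) (k j : ℕ) :
    (eigenTerm τ k : Term L [] τ).inst (θ.rename τ k j) = eigenTerm τ j := by
  cases τ <;> exact Function.update_self _ _ _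

theorem Sequent.inst_rename (θ : Subst L) {τ : Srt} {k : ℕ} (j : ℕ) {S : Sequent L}
    (h : ¬ S.Occurs (eigen τ k)) : S.inst (θ.rename τ k j) = S.inst θ :=
  Sequent.inst_congr fun _ hx => θ.rename_of_ne j fun e => h (e ▸ hx)

/-- The old eigenvariable is absent from the conclusion, so `θ` and its renaming agree there, side
formulas included. In the premise the renaming turns the old eigenvariable into number `j`, and `hj`
is the new eigenvariable condition. -/
theorem Strong.inst (θ : Subst L) {τ : Srt} {k j : ℕ} {S S' : Sequent L} (h : Strong τ k S S')
    (hj : ¬ (S'.inst θ).Occurs (eigen τ j)) :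
    Strong τ j (S.inst (θ.rename τ k j)) (S'.inst θ) := by
  cases h with
  | allR Γ Δ A h =>
    rw [← Sequent.inst_rename θ j h] at hj ⊢
    simp only [Sequent.inst, Multiset.map_cons, Fml.opened_inst, eigenTerm_inst_rename] at hj ⊢
    exact .allR _ _ _ hj
  | exL Γ Δ A h =>
    rw [← Sequent.inst_rename θ j h] at hj ⊢
    simp only [Sequent.inst, Multiset.map_cons, Fml.opened_inst, eigenTerm_inst_rename] at hj ⊢
    exact .exL _ _ _ hj

variable {Ax : Set (Sequent L)} {P : Set ℕ}

/-! ## Uniqueness of normal forms -/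

theorem numeral_injective {Γ : List Srt} :
    Function.Injective (numeral : ℕ → Term L Γ .num) := by
  intro m n h
  induction m generalizing n with
  | zero => cases n with
    | zero => rfl
    | succ n => cases h
  | succ m ih => cases n with
    | zero => cases h
    | succ n => exact congrArg _ (ih (Term.succ.inj h))

namespace PSchema

variable {Ψ : PSchema E Ax P}

theorem LinkStep.link_inv {S : Sequent L} {ψ : ℕ} {θ : Subst L} {d : Tree L}
    (h : Ψ.LinkStep (.link S ψ θ) d) : ∃ i, ψ = (Ψ.comp i).name ∧
      ((θ (.active (Ψ.comp i).act) = numeral 0 ∧ d = (Ψ.comp i).base.inst θ) ∨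
        ∃ k, θ (.active (Ψ.comp i).act) = numeral (k + 1) ∧
          d = (Ψ.comp i).step.inst (θ.set (.active (Ψ.comp i).act) (numeral k))) := by
  generalize e : Tree.link S ψ θ = t at h
  cases h <;> injection e
  case zero i S θ h e₁ e₂ e₃ => subst e₂ e₃; exact ⟨i, rfl, .inl ⟨h, rfl⟩⟩
  case succ i S θ k h e₁ e₂ e₃ => subst e₂ e₃; exact ⟨i, rfl, .inr ⟨k, h, rfl⟩⟩

/-- The proof symbol determines the component, and the numeral determines the case and the
predecessor. -/
theorem LinkStep.link_unique {S : Sequent L} {ψ : ℕ} {θ : Subst L} {d d' : Tree L}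
    (h : Ψ.LinkStep (.link S ψ θ) d) (h' : Ψ.LinkStep (.link S ψ θ) d') : d = d' := by
  obtain ⟨i, hi, h⟩ := h.link_inv
  obtain ⟨j, hj, h'⟩ := h'.link_inv
  obtain rfl : i = j := Ψ.name_injective (hi.symm.trans hj)
  rcases h with ⟨hn, rfl⟩ | ⟨k, hn, rfl⟩ <;> rcases h' with ⟨hn', rfl⟩ | ⟨m, hn', rfl⟩
  · rfl
  · cases numeral_injective (hn.symm.trans hn')
  · cases numeral_injective (hn.symm.trans hn')
  · cases numeral_injective (hn.symm.trans hn'); rfl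

/-- Redexes are leaves, so distinct ones lie in disjoint subtrees, and unfolding one neither copies
nor erases the other. -/
theorem LinkStep.diamond {a b c : Tree L} (h : Ψ.LinkStep a b) (h' : Ψ.LinkStep a c) :
    b = c ∨ ∃ d, Ψ.LinkStep b d ∧ Ψ.LinkStep c d := by
  induction h generalizing c with
  | zero i S θ h => exact .inl ((LinkStep.zero i S θ h).link_unique h')
  | succ i S θ k h => exact .inl ((LinkStep.succ i S θ k h).link_unique h')
  | unary S p p' h ih =>
    cases h' with | unary _ _ q h' =>
    rcases ih h' with rfl | ⟨d, h₁, h₂⟩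
    exacts [.inl rfl, .inr ⟨_, .unary _ _ _ h₁, .unary _ _ _ h₂⟩]
  | conv S p p' h ih =>
    cases h' with | conv _ _ q h' =>
    rcases ih h' with rfl | ⟨d, h₁, h₂⟩
    exacts [.inl rfl, .inr ⟨_, .conv _ _ _ h₁, .conv _ _ _ h₂⟩]
  | binaryL S p p' q h ih =>
    cases h' with
    | binaryL _ _ r _ h' =>
      rcases ih h' with rfl | ⟨d, h₁, h₂⟩
      exacts [.inl rfl, .inr ⟨_, .binaryL _ _ _ _ h₁, .binaryL _ _ _ _ h₂⟩]
    | binaryR _ _ _ r h' => exact .inr ⟨_, .binaryR _ _ _ _ h', .binaryL _ _ _ _ h⟩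
  | binaryR S p q q' h ih =>
    cases h' with
    | binaryL _ _ r _ h' => exact .inr ⟨_, .binaryL _ _ _ _ h', .binaryR _ _ _ _ h⟩
    | binaryR _ _ _ r h' =>
      rcases ih h' with rfl | ⟨d, h₁, h₂⟩
      exacts [.inl rfl, .inr ⟨_, .binaryR _ _ _ _ h₁, .binaryR _ _ _ _ h₂⟩]
  | strong S τ k p p' h ih =>
    cases h' with | strong _ _ _ _ q h' =>
    rcases ih h' with rfl | ⟨d, h₁, h₂⟩
    exacts [.inl rfl, .inr ⟨_, .strong _ _ _ _ _ h₁, .strong _ _ _ _ _ h₂⟩]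

theorem IsNormalForm.unique {d d₁ d₂ : Tree L} (h₁ : Ψ.IsNormalForm d d₁)
    (h₂ : Ψ.IsNormalForm d d₂) : d₁ = d₂ := by
  obtain ⟨e, he₁, he₂⟩ := Relation.church_rosser (r := Ψ.LinkStep) (fun a b c hb hc => by
    rcases hb.diamond hc with rfl | ⟨d, h₁, h₂⟩
    exacts [⟨_, .refl, .refl⟩, ⟨d, .single h₁, .single h₂⟩]) h₁.1 h₂.1
  rw [eq_of_reflTransGen_of_normal he₁ h₁.2, eq_of_reflTransGen_of_normal he₂ h₂.2]

end PSchema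

/-! ## Numeric terms -/

theorem Term.occurs_or_eq_numeral : ∀ t : Term L [] .num, t.Schematic →
    (∃ x, t.Occurs x) ∨ ∃ k, t = numeral k
  | .fvar x _, _ => .inl ⟨x, rfl⟩
  | .zero, _ => .inr ⟨0, rfl⟩
  | .succ t, h => by
    rcases t.occurs_or_eq_numeral h with ⟨x, hx⟩ | ⟨k, rfl⟩
    exacts [.inl ⟨x, hx⟩, .inr ⟨k + 1, rfl⟩]

theorem Term.Schematic.sort_eq {Γ : List Srt} {τ : Srt} {t : Term L Γ τ} (h : t.Schematic)
    {x : Var} (hx : t.Occurs x) : x.sort = .num := by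
  induction t with
  | bvar | app => exact h.elim
  | fvar y e => exact hx ▸ h
  | zero => exact hx.elim
  | succ t ih => exact ih h hx

/-- The dichotomy for active arguments during evaluation: in the first case the link is stuck, in
the second it is a redex. -/
theorem Term.Schematic.exists_passive_or_eq_numeral {t : Term L [] .num} (h : t.Schematic)
    (h' : t.PassiveOnly) : (∃ j, t.Occurs (.passive j)) ∨ ∃ k, t = numeral k := by
  refine (t.occurs_or_eq_numeral h).imp_left ?_
  rintro ⟨x, hx⟩
  cases x with
  | active k => exact ((h' k).1 hx).elim
  | passive k => exact ⟨k, hx⟩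
  | internal k => exact ((h' k).2 hx).elim
  | ind k => cases h.sort_eq hx

theorem Term.Schematic.inst {θ : Subst L} (hθ : ∀ x : Var, x.sort = .num → (θ x).Schematic)
    {τ : Srt} {t : Term L [] τ} (h : t.Schematic) : (t.inst θ).Schematic := by
  induction t with
  | bvar | app => exact h.elim
  | fvar y e => subst e; exact hθ y h
  | zero => trivial
  | succ t ih => exact ih h

theorem numeral_not_occurs {Γ : List Srt} (x : Var) :
    ∀ k, ¬ (numeral k : Term L Γ .num).Occurs x
  | 0 => fun h => h
  | k + 1 => numeral_not_occurs x k

theorem numeral_schematic {Γ : List Srt} : ∀ k, (numeral k : Term L Γ .num).Schematic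
  | 0 => trivial
  | k + 1 => numeral_schematic (Γ := Γ) k

theorem numeral_passiveOnly {Γ : List Srt} (k : ℕ) : (numeral k : Term L Γ .num).PassiveOnly :=
  fun _ => ⟨numeral_not_occurs _ k, numeral_not_occurs _ k⟩

/-! ## Existence of normal forms -/

theorem Sequent.inst_not_occurs {θ : Subst L} (hθ : ∀ x, (θ x).PassiveOnly)
    (S : Sequent L) (k : ℕ) :
    ¬ (S.inst θ).Occurs (.active k) ∧ ¬ (S.inst θ).Occurs (.internal k) :=
  ⟨fun h => let ⟨y, _, hy⟩ := Sequent.occurs_inst h; (hθ y k).1 hy,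
    fun h => let ⟨y, _, hy⟩ := Sequent.occurs_inst h; (hθ y k).2 hy⟩

theorem Tree.inst_concl (θ : Subst L) (p : Tree L) :
    (p.inst θ).concl = p.concl.inst θ := by
  cases p <;> rfl

/-- Transfers the restrictions on active parameters of a derivation to the arguments of its links.
-/
theorem Tree.HasLink.occurs {S : Sequent L} {ψ : ℕ} {ρ : Subst L} {p : Tree L}
    (h : p.HasLink S ψ ρ) {x y : Var} (hy : ∀ m, y ≠ .passive m) (hx : (ρ y).Occurs x) :
    p.Occurs x := by
  induction p with
  | init => exact h.elim
  | link => obtain ⟨rfl, rfl, rfl⟩ := h; exact .inr ⟨y, hy, hx⟩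
  | unary S p ih | conv S p ih => exact .inr (ih h)
  | binary S p q ihp ihq => exact .inr (h.imp ihp ihq)
  | strong S τ k p ih => exact .inr (.inr (ih h))

/-- Unfolding a link preserves its sequent: `t` is zero with `θ' = θ` in the base case, and the
successor of the active parameter with `θ'` lowered by one there in the step case. -/
theorem Sequent.inst_replaceActive {θ θ' : Subst L} {n : ℕ}
    {t : Term L [] .num} (h : t.inst θ' = θ (.active n)) (h' : ∀ x, x ≠ .active n → θ' x = θ x)
    (S : Sequent L) : (S.inst (replaceActive n t)).inst θ' = S.inst θ := by
  rw [Sequent.inst_inst]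
  refine Sequent.inst_congr fun x _ => ?_
  unfold Subst.comp replaceActive
  by_cases e : x = .active n
  · subst e; rw [Subst.set, Function.update_self]; exact h
  · rw [Subst.set, Function.update_of_ne e, ← h' x e]; rfl

namespace PSchema

/-! ### Evaluation and admissible substitutions -/

variable (Ψ : PSchema E Ax P)

/-- The tree has a normal form that is an LK-proof over the theory of the schema with the same
end-sequent. -/
def Evaluates (d : Tree L) : Prop :=
  ∃ d', Ψ.IsNormalForm d d' ∧ IsLKProofOver E Ax Ψ.theory d' ∧ d'.concl = d.concl

/-- Some link to component `i` passes a computational term for the numeric parameter `x`. -/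
def PassesComputational (i : Fin (Ψ.len + 1)) (x : Var) (hx : x.sort = .num) : Prop :=
  ∃ j S ρ, (Ψ.comp j).HasLink S (Ψ.comp i).name ρ ∧ Ψ.ComputationalTerm j (hx ▸ ρ x)

/-- The substitutions that arise for component `i` during evaluation: a parameter may be replaced
by a term that is not ground only if it is an eigenvariable or if some link passes a computational
term for it. -/
structure Admissible (i : Fin (Ψ.len + 1)) (θ : Subst L) : Prop where
  passiveOnly : ∀ x, (θ x).PassiveOnly
  schematic : ∀ x : Var, x.sort = .num → (θ x).Schematic
  passive : ∀ k j, (θ (.passive k)).Occurs (.passive j) → Ψ.UsesEigen k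
  internal : ∀ m j, (θ (.internal m)).Occurs (.passive j) →
    Ψ.PassesComputational i (.internal m) rfl
  active : ∀ j, (θ (.active (Ψ.comp i).act)).Occurs (.passive j) →
    Ψ.PassesComputational i (.active (Ψ.comp i).act) rfl

variable {Ψ}

theorem Evaluates.of_step {d d' : Tree L} (h : Ψ.LinkStep d d') (hc : d'.concl = d.concl)
    (h' : Ψ.Evaluates d') : Ψ.Evaluates d := by
  obtain ⟨e, he, hp, hce⟩ := h'
  exact ⟨e, ⟨.head h he.1, he.2⟩, hp, hce.trans hc⟩

/-- A passive parameter in the instance comes from the value at some variable of `t`. Active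
parameters are excluded by `hact` and individual variables by their sort; admissibility makes a
passive source an eigenvariable and an internal one the receiver of a computational term. -/
theorem Admissible.computationalTerm {i : Fin (Ψ.len + 1)} {θ : Subst L}
    (hθ : Ψ.Admissible i θ) {t : Term L [] .num} (ht : t.Schematic)
    (hact : ∀ k, t.Occurs (.active k) → ∀ j, ¬ (θ (.active k)).Occurs (.passive j)) {j : ℕ}
    (h : (t.inst θ).Occurs (.passive j)) : Ψ.ComputationalTerm i t := by
  obtain ⟨y, hy, hj⟩ := Term.occurs_inst h
  cases y with
  | active k => exact (hact k hy j hj).elim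
  | passive k => exact .passive i t k (hθ.passive k j hj) hy
  | internal m =>
    obtain ⟨j', S, ρ, hl, hc⟩ := hθ.internal m j hj
    exact .internal i j' t m hy S ρ hl hc
  | ind k => cases ht.sort_eq hy

/-- The invariant passes from a component to the target of a link: this very link witnesses that a
computational term is passed, and passive parameters keep their values under `θ`. -/
theorem Admissible.link {i j : Fin (Ψ.len + 1)} {θ : Subst L} (hθ : Ψ.Admissible i θ)
    {S : Sequent L} {ρ : Subst L} (hl : (Ψ.comp i).HasLink S (Ψ.comp j).name ρ)
    (hρ : IsLinkTo (Ψ.comp j) S ρ)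
    (hact : ∀ k y, (∀ m, y ≠ .passive m) → (ρ y).Occurs (.active k) →
      ∀ j, ¬ (θ (.active k)).Occurs (.passive j)) :
    Ψ.Admissible j (ρ.comp θ) where
  passiveOnly x := .inst hθ.passiveOnly _
  schematic x hx := by
    refine .inst hθ.schematic ?_
    cases x with
    | active k => exact hρ.active_schematic k
    | passive k => rw [hρ.passive]; rfl
    | internal k => exact hρ.internal_schematic k
    | ind k => cases hx
  passive k m h := by
    unfold Subst.comp at h
    rw [hρ.passive] at h
    exact hθ.passive k m h
  internal k m h := ⟨i, S, ρ, hl, hθ.computationalTerm (hρ.internal_schematic k)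
    (fun n => hact n _ fun _ => Var.noConfusion) h⟩
  active m h := ⟨i, S, ρ, hl, hθ.computationalTerm (hρ.active_schematic _)
    (fun n => hact n _ fun _ => Var.noConfusion) h⟩

/-- Renaming may make the value at a passive parameter non-ground, but only at an eigenvariable,
which admissibility allows. -/
theorem Admissible.rename {i : Fin (Ψ.len + 1)} {θ : Subst L} (hθ : Ψ.Admissible i θ) {τ : Srt}
    {k : ℕ} (j : ℕ) (hk : ∀ m, eigen τ k = .passive m → Ψ.UsesEigen m) :
    Ψ.Admissible i (θ.rename τ k j) := by
  refine ⟨fun x => ?_, fun x hx => ?_, fun m n h => ?_, fun m n h => ?_, fun n h => ?_⟩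
  · by_cases e : x = eigen τ k
    · subst e
      cases τ <;> simp [Subst.rename, Subst.set, eigenTerm, Term.PassiveOnly, Term.Occurs, eigen]
    · rw [θ.rename_of_ne j e]; exact hθ.passiveOnly x
  · by_cases e : x = eigen τ k
    · subst e
      cases τ <;> simp_all [Subst.rename, Subst.set, eigenTerm, Term.Schematic, eigen]
    · rw [θ.rename_of_ne j e]; exact hθ.schematic x hx
  · by_cases e : Var.passive m = eigen τ k
    · exact hk m e.symm
    · rw [θ.rename_of_ne j e] at h; exact hθ.passive m n h
  · rw [θ.rename_of_ne j (by cases τ <;> simp [eigen])] at h; exact hθ.internal m n h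
  · rw [θ.rename_of_ne j (by cases τ <;> simp [eigen])] at h; exact hθ.active n h

theorem Admissible.set_numeral {i : Fin (Ψ.len + 1)} {θ : Subst L} (hθ : Ψ.Admissible i θ)
    (n k : ℕ) : Ψ.Admissible i (θ.set (.active n) (numeral k)) := by
  have hne : ∀ x, x ≠ .active n → θ.set (.active n) (numeral k) x = θ x := fun x hx =>
    Function.update_of_ne hx _ _
  have heq : θ.set (.active n) (numeral k) (.active n) = numeral k := Function.update_self _ _ _
  refine ⟨fun x => ?_, fun x hx => ?_, fun m j h => ?_, fun m j h => ?_, fun j h => ?_⟩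
  · by_cases e : x = .active n
    · subst e; rw [heq]; exact numeral_passiveOnly k
    · rw [hne x e]; exact hθ.passiveOnly x
  · by_cases e : x = .active n
    · subst e; rw [heq]; exact numeral_schematic k
    · rw [hne x e]; exact hθ.schematic x hx
  · rw [hne _ Var.noConfusion] at h; exact hθ.passive m j h
  · rw [hne _ Var.noConfusion] at h; exact hθ.internal m j h
  · by_cases e : Var.active (Ψ.comp i).act = .active n
    · rw [e, heq] at h; exact (numeral_not_occurs _ k h).elim
    · rw [hne _ e] at h; exact hθ.active j h

/-! ### Evaluating derivations and links -/

theorem LinkStep.lift {f : Tree L → Tree L}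
    (hf : ∀ {p p'}, Ψ.LinkStep p p' → Ψ.LinkStep (f p) (f p')) {p p' : Tree L}
    (h : Relation.ReflTransGen Ψ.LinkStep p p') :
    Relation.ReflTransGen Ψ.LinkStep (f p) (f p') := by
  induction h with
  | refl => exact .refl
  | tail _ h ih => exact ih.tail (hf h)

/-- An instance of a derivation evaluates as soon as the instances of its links do. -/
theorem evaluates_inst (hE : E.Convergent) (hAx : SubstClosed Ax) {i : Fin (Ψ.len + 1)}
    {p : Tree L} (hp : IsDerivation E Ax p) (heig : ∀ k, p.UsesEigen k → Ψ.UsesEigen k)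
    {θ : Subst L} (hθ : Ψ.Admissible i θ)
    (hlink : ∀ S ψ ρ, p.HasLink S ψ ρ → ∀ θ', Ψ.Admissible i θ' →
      (∀ k, θ' (.active k) = θ (.active k)) →
      Ψ.Evaluates (.link (S.inst θ') ψ (ρ.comp θ'))) :
    ∃ d, Ψ.IsNormalForm (p.inst θ) d ∧ IsLKProofOver E Ax Ψ.theory d ∧
      d.concl = p.concl.inst θ := by
  induction p generalizing θ with
  | init S =>
    exact ⟨_, ⟨.refl, fun _ h => by cases h⟩, ⟨hp.inst hAx θ, S.inst_not_occurs hθ.passiveOnly⟩,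
      rfl⟩
  | link S ψ ρ => exact hlink S ψ ρ ⟨rfl, rfl, rfl⟩ θ hθ fun _ => rfl
  | unary S p ih =>
    obtain ⟨d, hd, hk, hc⟩ := ih hp.1 heig hθ hlink
    refine ⟨.unary (S.inst θ) d, ⟨LinkStep.lift (.unary _ _ _) hd.1, fun e h => ?_⟩,
      ⟨⟨hk.1, hc ▸ hp.2.inst hθ.passiveOnly⟩, fun k => ?_⟩, rfl⟩
    · cases h with | unary _ _ e h => exact hd.2 e h
    · have := S.inst_not_occurs hθ.passiveOnly k
      exact ⟨not_or.2 ⟨this.1, (hk.2 k).1⟩, not_or.2 ⟨this.2, (hk.2 k).2⟩⟩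
  | conv S p ih =>
    obtain ⟨d, hd, hk, hc⟩ := ih hp.1 heig hθ hlink
    refine ⟨.conv (S.inst θ) d, ⟨LinkStep.lift (.conv _ _ _) hd.1, fun e h => ?_⟩,
      ⟨⟨hk.1, hc ▸ hp.2.sameNormalForm_inst hE θ⟩, fun k => ?_⟩, rfl⟩
    · cases h with | conv _ _ e h => exact hd.2 e h
    · have := S.inst_not_occurs hθ.passiveOnly k
      exact ⟨not_or.2 ⟨this.1, (hk.2 k).1⟩, not_or.2 ⟨this.2, (hk.2 k).2⟩⟩
  | binary S p q ihp ihq =>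
    obtain ⟨d, hd, hk, hc⟩ := ihp hp.1 (fun k h => heig k (.inl h)) hθ
      fun S ψ ρ h => hlink S ψ ρ (.inl h)
    obtain ⟨d', hd', hk', hc'⟩ := ihq hp.2.1 (fun k h => heig k (.inr h)) hθ
      fun S ψ ρ h => hlink S ψ ρ (.inr h)
    refine ⟨.binary (S.inst θ) d d', ⟨(LinkStep.lift (f := fun p => .binary _ p _)
      (.binaryL _ _ _ _) hd.1).trans (LinkStep.lift (.binaryR _ _ _ _) hd'.1), fun e h => ?_⟩,
      ⟨⟨hk.1, hk'.1, hc ▸ hc' ▸ hp.2.2.inst θ⟩, fun k => ?_⟩, rfl⟩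
    · cases h with
      | binaryL _ _ e _ h => exact hd.2 e h
      | binaryR _ _ _ e h => exact hd'.2 e h
    · have := S.inst_not_occurs hθ.passiveOnly k
      exact ⟨not_or.2 ⟨this.1, not_or.2 ⟨(hk.2 k).1, (hk'.2 k).1⟩⟩,
        not_or.2 ⟨this.2, not_or.2 ⟨(hk.2 k).2, (hk'.2 k).2⟩⟩⟩
  | strong S τ k p ih =>
    -- Above a strong inference the substitution differs from `θ` at the eigenvariable. This is why
    -- `hlink` ranges over all admissible `θ'` that agree with `θ` on active parameters only.
    have hne : ∀ m, (θ.rename τ k (freshFor (S.inst θ) τ k)) (.active m) = θ (.active m) :=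
      fun m => θ.rename_of_ne _ (by cases τ <;> simp [eigen])
    obtain ⟨d, hd, hk, hc⟩ := ih hp.1 (fun k h => heig k (.inr h))
      (hθ.rename (freshFor (S.inst θ) τ k) fun m e => heig m (.inl e))
      fun S ψ ρ h θ' hθ' ha => hlink S ψ ρ h θ' hθ' fun m => (ha m).trans (hne m)
    refine ⟨.strong (S.inst θ) τ (freshFor (S.inst θ) τ k) d,
      ⟨LinkStep.lift (.strong _ _ _ _ _) hd.1, fun e h => ?_⟩,
      ⟨⟨hk.1, hc ▸ hp.2.inst θ (freshFor_not_occurs _ _ _)⟩, fun m => ?_⟩, rfl⟩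
    · cases h with | strong _ _ _ _ e h => exact hd.2 e h
    · have := S.inst_not_occurs hθ.passiveOnly m
      exact ⟨not_or.2 ⟨this.1, not_or.2 ⟨by cases τ <;> simp [eigen], (hk.2 m).1⟩⟩,
        not_or.2 ⟨this.2, not_or.2 ⟨by cases τ <;> simp [eigen], (hk.2 m).2⟩⟩⟩

variable (Ψ) in
/-- The sub-schema of all components that are above component `i`. -/
def above (i : Fin (Ψ.len + 1)) : Ψ.SubSchema where
  carrier := {j | j = i ∨ Ψ.lt i j}
  root := i
  root_mem := .inl rfl
  root_least _ h hne := h.resolve_left hne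
  closed := by
    intro j hj k S θ h
    obtain ⟨k', hk, _, hl⟩ := Ψ.link_target j S _ θ h
    obtain rfl := Ψ.name_injective hk
    rcases hl with rfl | hl
    · exact hj
    · rcases hj with rfl | hj
      exacts [.inr hl, .inr (Ψ.lt_trans _ _ _ hj hl)]

/-- A link that passes no numeral for the active parameter is normal, and its sequent belongs to
the theory. -/
theorem Admissible.evaluates_of_occurs {i : Fin (Ψ.len + 1)} {θ : Subst L}
    (hθ : Ψ.Admissible i θ) {j : ℕ} (hj : (θ (.active (Ψ.comp i).act)).Occurs (.passive j)) :
    Ψ.Evaluates (.link ((Ψ.comp i).es.inst θ) (Ψ.comp i).name θ) := by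
  refine ⟨_, ⟨.refl, fun d h => ?_⟩, ⟨?_, fun k => ?_⟩, rfl⟩
  · obtain ⟨i', hi, h⟩ := h.link_inv
    obtain rfl := Ψ.name_injective hi
    rcases h with ⟨h, _⟩ | ⟨k, h, _⟩ <;> rw [h] at hj <;> exact numeral_not_occurs _ _ hj
  -- Admissibility turns the passive parameter in the active argument into a link passing a
  -- computational term, which is what makes the sub-schema above `i` computational.
  · exact ⟨Ψ.above i, hθ.active j hj, θ, hθ.passiveOnly, hθ.schematic, ⟨j, hj⟩, rfl⟩
  · have := Sequent.inst_not_occurs hθ.passiveOnly (Ψ.comp i).es k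
    exact ⟨not_or.2 ⟨this.1, fun ⟨y, _, h⟩ => (hθ.passiveOnly y k).1 h⟩,
      not_or.2 ⟨this.2, fun ⟨y, _, h⟩ => (hθ.passiveOnly y k).2 h⟩⟩

theorem wellFounded_gt (Ψ : PSchema E Ax P) : WellFounded fun i j => Ψ.lt j i :=
  haveI : Std.Irrefl fun i j => Ψ.lt j i := ⟨Ψ.lt_irrefl⟩
  haveI : IsTrans _ fun i j => Ψ.lt j i := ⟨fun i j k h h' => Ψ.lt_trans k j i h' h⟩
  Finite.wellFounded_of_trans_of_irrefl _

/-- A link in a proof `p` of component `i` evaluates under an admissible substitution that is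
ground on the active parameters of `p`, provided that its target does. -/
theorem Admissible.evaluates_link {i : Fin (Ψ.len + 1)} {θ : Subst L} (hθ : Ψ.Admissible i θ)
    {p : Tree L} (hp : ∀ S ψ ρ, p.HasLink S ψ ρ → (Ψ.comp i).HasLink S ψ ρ)
    (hact : ∀ k, p.Occurs (.active k) → ∀ j, ¬ (θ (.active k)).Occurs (.passive j))
    {S : Sequent L} {ψ : ℕ} {ρ : Subst L} (hl : p.HasLink S ψ ρ)
    (ih : ∀ j, Ψ.lt i j → ∀ θ', Ψ.Admissible j θ' →
      Ψ.Evaluates (.link ((Ψ.comp j).es.inst θ') (Ψ.comp j).name θ'))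
    (ihself : ψ = (Ψ.comp i).name → Ψ.Admissible i (ρ.comp θ) →
      Ψ.Evaluates (.link ((Ψ.comp i).es.inst (ρ.comp θ)) ψ (ρ.comp θ))) :
    Ψ.Evaluates (.link (S.inst θ) ψ (ρ.comp θ)) := by
  obtain ⟨j, rfl, hρ, hj⟩ := Ψ.link_target i S ψ ρ (hp _ _ _ hl)
  have hadm : Ψ.Admissible j (ρ.comp θ) :=
    hθ.link (hp _ _ _ hl) hρ fun k y hy hk => hact k (hl.occurs hy hk)
  rw [hρ.sequent, Sequent.inst_inst]
  rcases hj with rfl | hj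
  exacts [ihself rfl hadm, ih j hj _ hadm]

/-- The double induction: on the reversed order of the components, then on the numeral passed for
the active parameter. -/
theorem Admissible.evaluates (hE : E.Convergent) (hAx : SubstClosed Ax) (i : Fin (Ψ.len + 1)) :
    ∀ θ, Ψ.Admissible i θ →
      Ψ.Evaluates (.link ((Ψ.comp i).es.inst θ) (Ψ.comp i).name θ) := by
  induction i using Ψ.wellFounded_gt.induction with
  | _ i ih =>
  have hC := Ψ.isComponent i
  -- `θ` stays general in the induction on `n`, because a self-link may change the internal and
  -- individual arguments.
  have main : ∀ n θ, Ψ.Admissible i θ → θ (.active (Ψ.comp i).act) = numeral n →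
      Ψ.Evaluates (.link ((Ψ.comp i).es.inst θ) (Ψ.comp i).name θ) := by
    intro n
    induction n with
    | zero =>
      intro θ hθ hn
      have hc : ((Ψ.comp i).base.inst θ).concl = (Ψ.comp i).es.inst θ := by
        rw [Tree.inst_concl, hC.base_concl]
        exact Sequent.inst_replaceActive (θ := θ) (θ' := θ) (t := .zero) hn.symm (fun _ _ => rfl) _
      refine .of_step (.zero i _ θ hn) hc ?_
      unfold Evaluates
      rw [Tree.inst_concl]
      refine evaluates_inst hE hAx hC.base_derivation (fun k h => ⟨i, .inl h⟩) hθ ?_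
      intro S ψ ρ hl θ' hθ' _
      -- The base derivation has neither active parameters nor self-links, so the outer hypothesis
      -- suffices.
      exact hθ'.evaluates_link (fun _ _ _ => .inl) (fun k hk => (hC.base_inactive k hk).elim) hl
        ih fun e => by subst e; exact (Ψ.self_base i S ρ hl).elim
    | succ n ihn =>
      intro θ hθ hn
      have heq : θ.set (.active (Ψ.comp i).act) (numeral n) (.active (Ψ.comp i).act) =
        numeral n := Function.update_self _ _ _
      have hc : ((Ψ.comp i).step.inst (θ.set (.active (Ψ.comp i).act) (numeral n))).concl =
          (Ψ.comp i).es.inst θ := by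
        rw [Tree.inst_concl, hC.step_concl]
        refine Sequent.inst_replaceActive ?_ (fun x hx => Function.update_of_ne hx _ _) _
        rw [hn]
        exact congrArg Term.succ heq
      refine .of_step (.succ i _ θ n hn) hc ?_
      unfold Evaluates
      rw [Tree.inst_concl]
      refine evaluates_inst hE hAx hC.step_derivation (fun k h => ⟨i, .inr h⟩)
        (hθ.set_numeral _ n) ?_
      intro S ψ ρ hl θ' hθ' ha
      -- Renaming eigenvariables has not touched the active parameter: it still has the value `n`,
      -- which a self-link passes on unchanged, so `ihn` applies.
      have hn' := (ha (Ψ.comp i).act).trans heq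
      refine hθ'.evaluates_link (fun _ _ _ => .inr) (fun k hk => ?_) hl ih fun e hadm => ?_
      · rw [hC.step_active k hk, hn']
        exact fun _ => numeral_not_occurs _ n
      · subst e
        refine ihn _ hadm ?_
        unfold Subst.comp
        rw [Ψ.self_step i S ρ hl]
        exact hn'
  intro θ hθ
  rcases (hθ.schematic (.active (Ψ.comp i).act) rfl).exists_passive_or_eq_numeral
      (hθ.passiveOnly _) with
    ⟨j, hj⟩ | ⟨n, hn⟩
  exacts [hθ.evaluates_of_occurs hj, main n θ hθ hn]

theorem admissible_numeralSubst (Ψ : PSchema E Ax P) (i : Fin (Ψ.len + 1)) (σ μ a : ℕ → ℕ) :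
    Ψ.Admissible i (numeralSubst σ μ a) where
  passiveOnly x := by
    cases x with
    | active | passive | internal => exact numeral_passiveOnly _
    | ind k => exact fun _ => ⟨Var.noConfusion, Var.noConfusion⟩
  schematic x hx := by
    cases x with
    | active | passive | internal => exact numeral_schematic _
    | ind k => cases hx
  passive _ _ h := (numeral_not_occurs _ _ h).elim
  internal _ _ h := (numeral_not_occurs _ _ h).elim
  active _ h := (numeral_not_occurs _ _ h).elim

end PSchema

end PSchemata

/-! ### The soundness theorem -/

theorem mainTheorem5 {L : PSchemata.Signature} (E : PSchemata.RewriteSystem L)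
    (hE : E.Convergent) (Ax : Set (PSchemata.Sequent L)) (hAx : PSchemata.SubstClosed Ax)
    (P : Set ℕ) (Ψ : PSchemata.PSchema E Ax P) (σ μ a : ℕ → ℕ) :
    ∃ d : PSchemata.Tree L,
      (Ψ.IsNormalForm (Ψ.start σ μ a) d ∧
        ∀ d', Ψ.IsNormalForm (Ψ.start σ μ a) d' → d' = d) ∧
      PSchemata.IsLKProofOver E Ax Ψ.theory d ∧
      d.concl = Ψ.es.inst (PSchemata.numeralSubst σ μ a) ∧
      ((∀ k, ¬ Ψ.es.Occurs (.active k) ∧ ¬ Ψ.es.Occurs (.internal k)) →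
        d.concl = Ψ.es.inst (PSchemata.passiveSubst σ)) := by
  obtain ⟨d, hd, hp, hc⟩ := PSchemata.PSchema.Admissible.evaluates hE hAx 0 _
    (Ψ.admissible_numeralSubst 0 σ μ a)
  refine ⟨d, ⟨hd, fun d' hd' => hd'.unique hd⟩, hp, hc, fun h => ?_⟩
  -- The two substitutions differ only at active and internal parameters, which `h` excludes from
  -- the end-sequent.
  refine hc.trans (PSchemata.Sequent.inst_congr fun x hx => ?_)
  cases x with
  | active k => exact ((h k).1 hx).elim
  | passive k => rfl
  | internal k => exact ((h k).2 hx).elim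
  | ind k => rfl
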